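/- Let $X$ be a locally compact Hausdorff space, let $\sigma : X \to X$ be a proper continuous map, and let $C_0(X)$ be the algebra of continuous complex-valued functions on $X$ vanishing at infinity. For $x \in X$ and $f \in C_0(X)$ let $\pi_x(f)$ be the diagonal operator on $\mathcal H_x = \ell^2(\mathbb N)$, $\mathbb N = \{0, 1, 2, \dots\}$, given by $\pi_x(f)\xi = \big(f(x)\xi_0, f(\sigma(x))\xi_1, f(\sigma^{(2)}(x))\xi_2, \dots\big)$, and let $S_x$ be the forward shift $S_x\xi = (0, \xi_0, \xi_1, \dots)$. On the Hilbert space $\bigoplus_{x \in X} \mathcal H_x$ put $\pi(f) = \bigoplus_{x \in X} \pi_x(f)$ and $S = \bigoplus_{x \in X} S_x$. The semicrossed product $C_0(X) \times_\sigma \mathbb Z^+$ is the norm-closed (not necessarily unital, non-selfadjoint) algebra of bounded operators on $\bigoplus_{x \in X}\mathcal H_x$ generated by the operators $\pi(f)$ and $S\pi(f)$, $f \in C_0(X)$. **Theorem (Davidson–Katsoulis).** For $i = 1, 2$ let $X_i$ be a locally compact Hausdorff space and $\sigma_i : X_i \to X_i$ a proper continuous map. Then the dynamical systems $(X_1, \sigma_1)$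 and $(X_2, \sigma_2)$ are topologically conjugate, i.e. there is a homeomorphism $\gamma : X_1 \to X_2$ with $\gamma \circ \sigma_1 = \sigma_2 \circ \gamma$, if and only if the semicrossed products $C_0(X_1) \times_{\sigma_1} \mathbb Z^+$ and $C_0(X_2) \times_{\sigma_2} \mathbb Z^+$ are isomorphic as complex algebras, i.e. there is a bijective $\mathbb C$-linear multiplicative map (not assumed continuous) between them. -/

import Mathlib

open scoped ENNReal ZeroAtInfty

noncomputable section

namespace Semicrossed

/-- The Hilbert space `ℓ²(ℕ)` of square-summable complex sequences `(ξ₀, ξ₁, ξ₂, …)`. -/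
abbrev SeqSpace : Type := lp (fun _ : ℕ => ℂ) 2

/-- The Hilbert space direct sum of copies of `ℓ²(ℕ)` indexed by the points of `X`. -/
abbrev OrbitSpace (X : Type*) : Type _ := lp (fun _ : X => SeqSpace) 2

/-- The underlying function `(ξ₀, ξ₁, …) ↦ (0, ξ₀, ξ₁, …)` of the forward shift. -/
def shiftFun (ξ : ℕ → ℂ) : ℕ → ℂ
  | 0 => 0
  | n + 1 => ξ n

lemma hasSum_norm_shiftFun (ξ : SeqSpace) :
    HasSum (fun n => ‖shiftFun ξ n‖ ^ (2 : ℝ≥0∞).toReal) (‖ξ‖ ^ (2 : ℝ≥0∞).toReal) := by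
  have h := lp.hasSum_norm (p := 2) (by norm_num) ξ
  rw [← hasSum_nat_add_iff' 1]
  simpa [shiftFun] using h

/-- The forward shift on `ℓ²(ℕ)`, as a linear isometry. -/
def shiftIsometry : SeqSpace →ₗᵢ[ℂ] SeqSpace where
  toFun ξ := ⟨shiftFun ξ, memℓp_gen (hasSum_norm_shiftFun ξ).summable⟩
  map_add' ξ η := by
    ext n
    cases n with
    | zero => exact (add_zero (0 : ℂ)).symm
    | succ n => rfl
  map_smul' c ξ := by
    ext n
    cases n <;> simp [shiftFun]
  norm_map' ξ := by
    have h := lp.norm_eq_tsum_rpow (p := 2) (by norm_num)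
      (⟨shiftFun ξ, memℓp_gen (hasSum_norm_shiftFun ξ).summable⟩ : SeqSpace)
    have h2 := (hasSum_norm_shiftFun ξ).tsum_eq
    refine h.trans ?_
    erw [h2]
    rw [← Real.rpow_mul (norm_nonneg ξ)]
    norm_num

/-- The forward shift on `ℓ²(ℕ)`, as a bounded operator. -/
def shift : SeqSpace →L[ℂ] SeqSpace := shiftIsometry.toContinuousLinearMap

lemma norm_shift_le : ‖shift‖ ≤ 1 := shiftIsometry.norm_toContinuousLinearMap_le

section

variable {X : Type*} [TopologicalSpace X]

lemma norm_apply_le (f : C₀(X, ℂ)) (x : X) : ‖f x‖ ≤ ‖f‖ := by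
  rw [← ZeroAtInftyContinuousMap.norm_toBCF_eq_norm]
  exact f.toBCF.norm_coe_le_norm x

lemma norm_smul_id_le (f : C₀(X, ℂ)) (x : X) :
    ‖f x • ContinuousLinearMap.id ℂ ℂ‖ ≤ ‖f‖ := by
  rw [norm_smul, ContinuousLinearMap.norm_id, mul_one]
  exact norm_apply_le f x

/-- The diagonal operator `π_x(f)` on `ℓ²(ℕ)`, with diagonal entries
`f(x), f(σ(x)), f(σ²(x)), …`. -/
def orbitDiag (σ : X → X) (f : C₀(X, ℂ)) (x : X) : SeqSpace →L[ℂ] SeqSpace :=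
  lp.mapCLM 2 (fun n : ℕ => f (σ^[n] x) • ContinuousLinearMap.id ℂ ℂ)
    (norm_nonneg f) (fun n => norm_smul_id_le f (σ^[n] x))

/-- The operator `π(f) = ⨁ₓ π_x(f)`. -/
def orbitRep (σ : X → X) (f : C₀(X, ℂ)) : OrbitSpace X →L[ℂ] OrbitSpace X :=
  lp.mapCLM 2 (fun x : X => orbitDiag σ f x) (norm_nonneg f)
    (fun _ => lp.norm_mapCLM_le 2 _ (norm_nonneg f) _)

variable (X) in
/-- The operator `S = ⨁ₓ S_x`, where every `S_x` is the forward shift. -/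
def orbitShift : OrbitSpace X →L[ℂ] OrbitSpace X :=
  lp.mapCLM 2 (fun _ : X => shift) zero_le_one (fun _ => norm_shift_le)

/-- The semicrossed product `C₀(X) ×_σ ℤ⁺`: the norm-closed (in general non-unital) algebra of
operators generated by all `π(f)` and all `S π(f)`, for `f ∈ C₀(X)`. -/
def semicrossedProduct (σ : X → X) :
    NonUnitalSubalgebra ℂ (OrbitSpace X →L[ℂ] OrbitSpace X) :=
  (NonUnitalAlgebra.adjoin ℂ
    (Set.range (fun f : C₀(X, ℂ) => orbitRep σ f) ∪
      Set.range (fun f : C₀(X, ℂ) => orbitShift X * orbitRep σ f))).topologicalClosure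

end

/-- Topological conjugacy of `(X₁, σ₁)` and `(X₂, σ₂)`: there is a homeomorphism
`γ : X₁ → X₂` with `γ ∘ σ₁ = σ₂ ∘ γ`. -/
def Conjugate {X₁ X₂ : Type*} [TopologicalSpace X₁] [TopologicalSpace X₂]
    (σ₁ : X₁ → X₁) (σ₂ : X₂ → X₂) : Prop :=
  ∃ γ : X₁ ≃ₜ X₂, γ ∘ σ₁ = σ₂ ∘ γ

/-- Isomorphism of (possibly non-unital) complex algebras: a bijective, `ℂ`-linear and
multiplicative map. No continuity is required. -/
def AlgebraIsomorphic (A B : Type*) [NonUnitalRing A] [Module ℂ A] [NonUnitalRing B]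
    [Module ℂ B] : Prop :=
  ∃ φ : A →ₙₐ[ℂ] B, Function.Bijective φ

end Semicrossed

end

/-! Conjugate systems have isomorphic algebras because a conjugacy permutes the summands `ℋ_x`.
Conversely, the system is read off from characters and from twisted derivations between them.

A nonzero character has the form `S ^ n π(f) ↦ ζ ^ n f(x)` with `‖ζ‖ ≤ 1`, and `ζ = 0` unless `σ x =
x` (`exists_isOver`). Characters are automatically contractive, so the isomorphism need not be
continuous. It carries characters to characters. A real-valued holomorphic function on the disc is
constant, so the base point does not move along a disc of characters; this yields a homeomorphism
`γ` (`exists_intertwining`). A fixed point carries several characters, any other point only one, so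
`γ` preserves fixed points (`Intertwines.fixed`).

For the dynamics at a non-fixed `x`, the first Fourier coefficient at `x` satisfies `d(ab) = d(a)
θ(b) + θ'(a) d(b)`, where `θ` and `θ'` are the central characters over `x` and `σ₁ x`, and `d` is
nonzero on `ker θ ∩ ker θ'` (`coeffOne_mul`). Transported by the isomorphism, it lies over `γ x` and
`γ (σ₁ x)`. By `derivation_eq_zero` this forces `γ (σ₁ x)` to be `γ x` or `σ₂ (γ x)`, and
injectivity of `γ` excludes the former. That lemma is algebraic in `d`, but needs the second
character in the open disc; the maximum principle ensures this (`Intertwines.norm_lt_one`). -/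

namespace Semicrossed

section Generators

/-! ### Coordinates of the generating operators -/

variable {X : Type*}

@[simp] lemma orbitShift_apply_zero (ξ : OrbitSpace X) (x : X) :
    orbitShift X ξ x 0 = 0 := rfl

@[simp] lemma orbitShift_apply_succ (ξ : OrbitSpace X) (x : X) (n : ℕ) :
    orbitShift X ξ x (n + 1) = ξ x n := rfl

lemma orbitSpace_ext {ξ η : OrbitSpace X} (h : ∀ x n, ξ x n = η x n) : ξ = η :=
  lp.ext (funext fun x => lp.ext (funext fun n => h x n))

lemma norm_orbitShift_apply (ξ : OrbitSpace X) : ‖orbitShift X ξ‖ = ‖ξ‖ := by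
  have h1 := lp.hasSum_norm (p := 2) (by norm_num) (orbitShift X ξ)
  have h2 := lp.hasSum_norm (p := 2) (by norm_num) ξ
  have h3 : ∀ x, ‖orbitShift X ξ x‖ = ‖ξ x‖ := fun x => shiftIsometry.norm_map (ξ x)
  simp only [h3] at h1
  have h4 := h1.unique h2
  exact (Real.rpow_left_inj (norm_nonneg _) (norm_nonneg _) (by norm_num)).1 h4

lemma norm_orbitShift_le : ‖orbitShift X‖ ≤ 1 :=
  lp.norm_mapCLM_le 2 _ zero_le_one _

variable [TopologicalSpace X]

@[simp] lemma orbitRep_apply (σ : X → X) (f : C₀(X, ℂ)) (ξ : OrbitSpace X) (x : X) (n : ℕ) :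
    orbitRep σ f ξ x n = f (σ^[n] x) * ξ x n := rfl

lemma norm_orbitRep_le (σ : X → X) (f : C₀(X, ℂ)) : ‖orbitRep σ f‖ ≤ ‖f‖ :=
  lp.norm_mapCLM_le 2 _ (norm_nonneg f) _

lemma orbitRep_add (σ : X → X) (f g : C₀(X, ℂ)) :
    orbitRep σ (f + g) = orbitRep σ f + orbitRep σ g := by
  ext1 ξ
  exact orbitSpace_ext fun x n => by simp [add_mul]

lemma orbitRep_smul (σ : X → X) (c : ℂ) (f : C₀(X, ℂ)) :
    orbitRep σ (c • f) = c • orbitRep σ f := by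
  ext1 ξ
  exact orbitSpace_ext fun x n => by simp [mul_assoc]

lemma orbitRep_mul (σ : X → X) (f g : C₀(X, ℂ)) :
    orbitRep σ (f * g) = orbitRep σ f * orbitRep σ g := by
  ext1 ξ
  exact orbitSpace_ext fun x n => by simp [mul_assoc]

/-- The representation `f ↦ π(f)` as a bounded linear map. -/
noncomputable def repL (σ : X → X) : C₀(X, ℂ) →L[ℂ] (OrbitSpace X →L[ℂ] OrbitSpace X) :=
  LinearMap.mkContinuous
    { toFun := orbitRep σ, map_add' := orbitRep_add σ, map_smul' := orbitRep_smul σ } 1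
    (fun f => by simpa using norm_orbitRep_le σ f)

@[simp] lemma repL_apply (σ : X → X) (f : C₀(X, ℂ)) : repL σ f = orbitRep σ f := rfl

lemma norm_le_of_forall_le {f : C₀(X, ℂ)} {C : ℝ} (hC : 0 ≤ C) (h : ∀ x, ‖f x‖ ≤ C) :
    ‖f‖ ≤ C := by
  rw [← ZeroAtInftyContinuousMap.norm_toBCF_eq_norm]
  exact (BoundedContinuousFunction.norm_le hC).2 h

lemma exists_compact_norm_lt (f : C₀(X, ℂ)) {ε : ℝ} (hε : 0 < ε) :
    ∃ K : Set X, IsCompact K ∧ ∀ x ∉ K, ‖f x‖ < ε := by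
  have h := f.zero_at_infty'.eventually (Metric.ball_mem_nhds (0 : ℂ) hε)
  obtain ⟨K, hK, hs⟩ := Filter.mem_cocompact.1 h
  refine ⟨K, hK, fun x hx => ?_⟩
  simpa using hs hx

/-! ### Pulling back functions along a proper map -/

lemma tendsto_cocompact_of_isProperMap [T2Space X] [LocallyCompactSpace X] {σ : X → X} (hσ : IsProperMap σ) :
    Filter.Tendsto σ (Filter.cocompact X) (Filter.cocompact X) :=
  (isProperMap_iff_tendsto_cocompact.1 hσ).2

/-- The function `f ∘ σ`. -/
noncomputable def pull [T2Space X] [LocallyCompactSpace X] {σ : X → X} (hσ : IsProperMap σ) (f : C₀(X, ℂ)) :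
    C₀(X, ℂ) :=
  f.comp ⟨⟨σ, hσ.continuous⟩, tendsto_cocompact_of_isProperMap hσ⟩

variable [T2Space X] [LocallyCompactSpace X] {σ : X → X} (hσ : IsProperMap σ)

@[simp] lemma pull_apply (f : C₀(X, ℂ)) (x : X) : pull hσ f x = f (σ x) := rfl

@[simp] lemma pull_iterate_apply (n : ℕ) (f : C₀(X, ℂ)) (x : X) :
    (pull hσ)^[n] f x = f (σ^[n] x) := by
  induction n generalizing x with
  | zero => rfl
  | succ n ih =>
    rw [Function.iterate_succ_apply', pull_apply, ih, ← Function.iterate_succ_apply]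

lemma orbitRep_mul_orbitShift (f : C₀(X, ℂ)) :
    orbitRep σ f * orbitShift X = orbitShift X * orbitRep σ (pull hσ f) := by
  ext1 ξ
  refine orbitSpace_ext fun x n => ?_
  cases n with
  | zero => simp
  | succ n => simp [-Function.iterate_succ, Function.iterate_succ_apply']

lemma orbitRep_mul_orbitShift_pow (f : C₀(X, ℂ)) (n : ℕ) :
    orbitRep σ f * orbitShift X ^ n = orbitShift X ^ n * orbitRep σ ((pull hσ)^[n] f) := by
  induction n with
  | zero => simp
  | succ n ih =>
    rw [pow_succ, ← mul_assoc, ih, mul_assoc, orbitRep_mul_orbitShift hσ, ← mul_assoc,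
      Function.iterate_succ_apply']

/-! ### Cutoff functions -/

lemma exists_cutoff {K U : Set X} (hK : IsCompact K) (hU : IsOpen U) (hKU : K ⊆ U) :
    ∃ g : C₀(X, ℂ), (∀ x ∈ K, g x = 1) ∧ (∀ x ∉ U, g x = 0) ∧
      ∀ x, ∃ r : ℝ, g x = r ∧ 0 ≤ r ∧ r ≤ 1 := by
  obtain ⟨f, h1, h0, hc, hr⟩ := exists_continuous_one_zero_of_isCompact hK hU.isClosed_compl
    (Set.disjoint_compl_right_iff_subset.2 hKU)
  refine ⟨⟨⟨fun x => (f x : ℂ), by fun_prop⟩, ?_⟩, ?_, ?_, ?_⟩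
  · have : HasCompactSupport (fun x => (f x : ℂ)) :=
      hc.comp_left (g := fun r : ℝ => (r : ℂ)) Complex.ofReal_zero
    exact this.is_zero_at_infty
  · intro x hx
    simpa using h1 hx
  · intro x hx
    simpa using h0 hx
  · exact fun x => ⟨f x, rfl, hr x⟩

lemma norm_cutoff_le {r : ℝ} {z : ℂ} (h : z = r) (h0 : 0 ≤ r) (h1 : r ≤ 1) : ‖z‖ ≤ 1 := by
  rw [h, Complex.norm_real, Real.norm_of_nonneg h0]
  exact h1

lemma exists_eq_one_at {x : X} {U : Set X} (hU : IsOpen U) (hx : x ∈ U) :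
    ∃ g : C₀(X, ℂ), g x = 1 ∧ (∀ y ∉ U, g y = 0) ∧
      ∀ x, ∃ r : ℝ, g x = r ∧ 0 ≤ r ∧ r ≤ 1 := by
  obtain ⟨g, h1, h2, h3⟩ := exists_cutoff (isCompact_singleton (x := x)) hU (by simpa using hx)
  exact ⟨g, h1 x rfl, h2, h3⟩

lemma exists_eq_one (x : X) : ∃ g : C₀(X, ℂ), g x = 1 ∧ ‖g‖ ≤ 1 := by
  obtain ⟨g, h1, -, h3⟩ := exists_eq_one_at isOpen_univ (Set.mem_univ x)
  refine ⟨g, h1, norm_le_of_forall_le zero_le_one fun y => ?_⟩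
  obtain ⟨r, hr, h0, h1⟩ := h3 y
  exact norm_cutoff_le hr h0 h1

lemma exists_separating {x y : X} (h : y ≠ x) : ∃ g : C₀(X, ℂ), g x = 1 ∧ g y = 0 := by
  obtain ⟨g, h1, h2, -⟩ := exists_eq_one_at (isOpen_compl_singleton (x := y))
    (show x ∈ ({y}ᶜ : Set X) from fun hh => h (by simpa using hh.symm))
  exact ⟨g, h1, h2 y (by simp)⟩

/-- Approximation of `f` by `(g ∘ σ^n) · f`, with a cutoff `g`. -/
lemma exists_approx_pull (n : ℕ) (f : C₀(X, ℂ)) {ε : ℝ} (hε : 0 < ε) :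
    ∃ g : C₀(X, ℂ), ‖f - (pull hσ)^[n] g * f‖ ≤ ε := by
  obtain ⟨K, hK, hf⟩ := exists_compact_norm_lt f hε
  -- With `g = 1` on `σ^n(K)`, the factor `1 - g ∘ σ^n` vanishes on `K`; off `K`, `f` itself is
  -- small.
  have hK' : IsCompact (σ^[n] '' K) := hK.image (hσ.continuous.iterate n)
  obtain ⟨g, h1, -, h3⟩ := exists_cutoff hK' isOpen_univ (Set.subset_univ _)
  refine ⟨g, norm_le_of_forall_le hε.le fun x => ?_⟩
  have e : (f - (pull hσ)^[n] g * f) x = (1 - g (σ^[n] x)) * f x := by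
    simp [sub_mul]
  rw [e, norm_mul]
  by_cases hx : x ∈ K
  · rw [h1 _ ⟨x, hx, rfl⟩]
    simpa using hε.le
  · obtain ⟨r, hr, h0, h1⟩ := h3 (σ^[n] x)
    have : ‖1 - g (σ^[n] x)‖ ≤ 1 :=
      norm_cutoff_le (r := 1 - r) (by rw [hr]; push_cast; rfl) (by linarith) (by linarith)
    have := hf x hx
    nlinarith [norm_nonneg (f x)]

end Generators

/-- The bounded operators on `⨁ₓ ℋ_x`. -/
abbrev Op (X : Type*) : Type _ := OrbitSpace X →L[ℂ] OrbitSpace X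

/-! ### Fourier coefficients and evaluation functionals -/

section Functionals

/-- The vector `(1, ζ̄, ζ̄², …)` of `ℓ²(ℕ)` for `‖ζ‖ < 1` (and zero otherwise). -/
noncomputable def geom (ζ : ℂ) : SeqSpace :=
  open Classical in
  if h : ‖ζ‖ < 1 then
    ⟨fun n => (starRingEnd ℂ ζ) ^ n, memℓp_gen (by
      have : Summable fun n : ℕ => (‖ζ‖ ^ 2) ^ n :=
        summable_geometric_of_lt_one (by positivity) (by nlinarith [norm_nonneg ζ])
      refine this.congr fun n => ?_
      rw [norm_pow, RCLike.norm_conj, ENNReal.toReal_ofNat, Real.rpow_ofNat, ← pow_mul, ← pow_mul,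
        mul_comm])⟩
  else 0

lemma geom_apply {ζ : ℂ} (h : ‖ζ‖ < 1) (n : ℕ) : geom ζ n = (starRingEnd ℂ ζ) ^ n := by
  rw [geom, dif_pos h]

variable {X : Type*}

/-- The first basis vector of the summand `ℋ_x`. -/
noncomputable def baseVec (x : X) : OrbitSpace X :=
  letI := Classical.decEq X
  lp.single 2 x (lp.single 2 0 1)

lemma norm_baseVec (x : X) : ‖baseVec x‖ = 1 := by
  classical
  refine (lp.norm_single (by norm_num) x _).trans ?_
  rw [lp.norm_single (by norm_num), norm_one]

/-- The functional `a ↦ ⟨v, a e_{x,0}⟩`, where `v` is regarded as a vector of `ℋ_x`. -/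
noncomputable def vecFunctional (v : SeqSpace) (x : X) :
    (Op X) →L[ℂ] ℂ :=
  open Classical in
  (innerSL ℂ (lp.single 2 x v : OrbitSpace X)).comp (ContinuousLinearMap.apply ℂ _ (baseVec x))

lemma vecFunctional_apply (v : SeqSpace) (x : X) (a : Op X) :
    vecFunctional v x a = inner ℂ v (a (baseVec x) x) := by
  classical
  simp only [vecFunctional, ContinuousLinearMap.comp_apply, ContinuousLinearMap.apply_apply,
    innerSL_apply_apply]
  exact lp.inner_single_left (𝕜 := ℂ) x v (a (baseVec x))

lemma hasSum_vecFunctional (v : SeqSpace) (x : X) (a : Op X) :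
    HasSum (fun n => starRingEnd ℂ (v n) * a (baseVec x) x n) (vecFunctional v x a) := by
  rw [vecFunctional_apply]
  have h := lp.hasSum_inner (𝕜 := ℂ) v (a (baseVec x) x)
  simp only [RCLike.inner_apply] at h
  simpa only [mul_comm] using h

lemma norm_vecFunctional_le (v : SeqSpace) (x : X) (a : Op X) :
    ‖vecFunctional v x a‖ ≤ ‖v‖ * ‖a‖ := by
  classical
  rw [vecFunctional_apply]
  refine (norm_inner_le_norm _ _).trans (mul_le_mul_of_nonneg_left ?_ (norm_nonneg _))
  refine (lp.norm_apply_le_norm (by norm_num) (a (baseVec x)) x).trans ?_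
  simpa [norm_baseVec] using a.le_opNorm (baseVec x)

lemma norm_coeff_le (x : X) (a : Op X) (n : ℕ) :
    ‖a (baseVec x) x n‖ ≤ ‖a‖ := by
  refine (lp.norm_apply_le_norm (by norm_num) (a (baseVec x) x) n).trans ?_
  refine (lp.norm_apply_le_norm (by norm_num) (a (baseVec x)) x).trans ?_
  simpa [norm_baseVec] using a.le_opNorm (baseVec x)

/-- The functional `S ^ n π(f) ↦ ζ ^ n f(x)`, for `‖ζ‖ < 1`. -/
noncomputable def evalAt (x : X) (ζ : ℂ) : (Op X) →L[ℂ] ℂ :=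
  vecFunctional (geom ζ) x

lemma hasSum_evalAt (x : X) {ζ : ℂ} (h : ‖ζ‖ < 1) (a : Op X) :
    HasSum (fun n => ζ ^ n * a (baseVec x) x n) (evalAt x ζ a) := by
  have h1 := hasSum_vecFunctional (geom ζ) x a
  simp only [geom_apply h, map_pow, Complex.conj_conj] at h1
  exact h1

lemma evalAt_shift_mul (x : X) {ζ : ℂ} (h : ‖ζ‖ < 1) (a : Op X) :
    evalAt x ζ (orbitShift X * a) = ζ * evalAt x ζ a := by
  refine (hasSum_evalAt x h _).unique ?_
  rw [← hasSum_nat_add_iff' 1, Finset.sum_range_one, _root_.mul_apply_eq_comp,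
    orbitShift_apply_zero, mul_zero, sub_zero]
  have h1 := (hasSum_evalAt x h a).mul_left ζ
  simp only [← mul_assoc, ← pow_succ'] at h1
  exact h1

/-- A power series with coefficients bounded by `‖a‖`. It is dominated uniformly only on discs of
radius `r < 1`, hence the intermediate radius. -/
lemma differentiableOn_evalAt (x : X) (a : Op X) :
    DifferentiableOn ℂ (fun z => evalAt x z a) (Metric.ball 0 1) := by
  intro z hz
  rw [mem_ball_zero_iff] at hz
  obtain ⟨r, hr, hr1⟩ := exists_between hz
  have hr0 : 0 ≤ r := (norm_nonneg z).trans hr.le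
  have h : DifferentiableOn ℂ (fun w => ∑' n, w ^ n * a (baseVec x) x n) (Metric.ball 0 r) := by
    refine Complex.differentiableOn_tsum_of_summable_norm (u := fun n => r ^ n * ‖a‖)
      ((summable_geometric_of_lt_one hr0 hr1).mul_right _) (fun n => by fun_prop)
      Metric.isOpen_ball fun n w hw => ?_
    rw [mem_ball_zero_iff] at hw
    rw [norm_mul, norm_pow]
    gcongr
    exact norm_coeff_le x a n
  have hz' : Metric.ball (0 : ℂ) r ∈ nhds z :=
    Metric.isOpen_ball.mem_nhds (by simpa using hr)
  refine ((h.differentiableAt hz').congr_of_eventuallyEq ?_).differentiableWithinAt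
  filter_upwards [hz'] with w hw
  rw [mem_ball_zero_iff] at hw
  exact (hasSum_evalAt x (hw.trans hr1) a).tsum_eq.symm

variable [TopologicalSpace X]

/-- The orbit of the single vector `e_{x,0}` displays all Fourier coefficients at `x`. -/
lemma shift_pow_orbitRep_coeff (σ : X → X) (n : ℕ) (f : C₀(X, ℂ)) (x : X) (m : ℕ) :
    (orbitShift X ^ n * orbitRep σ f) (baseVec x) x m = if m = n then f x else 0 := by
  classical
  induction n generalizing m with
  | zero =>
    cases m with
    | zero => simp [baseVec]
    | succ m => simp [baseVec]
  | succ n ih =>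
    rw [pow_succ', mul_assoc]
    cases m with
    | zero => simp
    | succ m =>
      rw [_root_.mul_apply_eq_comp, orbitShift_apply_succ, ih]
      simp

lemma vecFunctional_shift_pow_orbitRep (v : SeqSpace) (σ : X → X) (n : ℕ) (f : C₀(X, ℂ)) (x : X) :
    vecFunctional v x (orbitShift X ^ n * orbitRep σ f) = starRingEnd ℂ (v n) * f x := by
  refine (hasSum_vecFunctional v x _).unique ?_
  simp only [shift_pow_orbitRep_coeff]
  convert hasSum_ite_eq n (starRingEnd ℂ (v n) * f x) using 2 with m
  split_ifs with h
  · rw [h]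
  · simp

lemma evalAt_shift_pow_orbitRep (σ : X → X) {ζ : ℂ} (h : ‖ζ‖ < 1) (n : ℕ) (f : C₀(X, ℂ))
    (x : X) : evalAt x ζ (orbitShift X ^ n * orbitRep σ f) = ζ ^ n * f x := by
  rw [evalAt, vecFunctional_shift_pow_orbitRep, geom_apply h, map_pow, Complex.conj_conj]

lemma evalAt_orbitRep (σ : X → X) {ζ : ℂ} (h : ‖ζ‖ < 1) (f : C₀(X, ℂ)) (x : X) :
    evalAt x ζ (orbitRep σ f) = f x := by
  simpa using evalAt_shift_pow_orbitRep σ h 0 f x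

/-- The functional `S ^ n π(f) ↦ f(x)` if `n = 1`, and `0` otherwise. -/
noncomputable def coeffOne (x : X) : (Op X) →L[ℂ] ℂ :=
  vecFunctional (lp.single 2 1 1) x

lemma coeffOne_shift_pow_orbitRep (σ : X → X) (n : ℕ) (f : C₀(X, ℂ)) (x : X) :
    coeffOne x (orbitShift X ^ n * orbitRep σ f) = if n = 1 then f x else 0 := by
  rw [coeffOne, vecFunctional_shift_pow_orbitRep]
  by_cases h : n = 1 <;> simp [h]

end Functionals

/-! ### Density of the span of `S ^ n π(f)`, product rules, and division by `S - ζ` -/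

section Structure

variable {X : Type*} [TopologicalSpace X] {σ : X → X}

lemma isClosed_semicrossedProduct : IsClosed (semicrossedProduct σ : Set (Op X)) :=
  NonUnitalSubalgebra.isClosed_topologicalClosure _

lemma orbitRep_mem (f : C₀(X, ℂ)) : orbitRep σ f ∈ semicrossedProduct σ :=
  NonUnitalSubalgebra.le_topologicalClosure _
    (NonUnitalAlgebra.subset_adjoin ℂ (Or.inl ⟨f, rfl⟩))

lemma shift_mul_orbitRep_mem (f : C₀(X, ℂ)) :
    orbitShift X * orbitRep σ f ∈ semicrossedProduct σ :=
  NonUnitalSubalgebra.le_topologicalClosure _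
    (NonUnitalAlgebra.subset_adjoin ℂ (Or.inr ⟨f, rfl⟩))

variable [T2Space X] [LocallyCompactSpace X] (hσ : IsProperMap σ)
include hσ

lemma shift_pow_mul_orbitRep_mul (n m : ℕ) (f g : C₀(X, ℂ)) :
    (orbitShift X ^ n * orbitRep σ f) * (orbitShift X ^ m * orbitRep σ g) =
      orbitShift X ^ (n + m) * orbitRep σ ((pull hσ)^[m] f * g) := by
  rw [mul_assoc, ← mul_assoc (orbitRep σ f), orbitRep_mul_orbitShift_pow hσ, orbitRep_mul,
    pow_add, mul_assoc, mul_assoc]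

/-- `S` itself need not lie in the algebra, so `S ^ (n + 1) π(f)` is reached as a limit of `Sπ(g) ·
S ^ n π(f) = S ^ (n + 1) π((g ∘ σ^n) f)`. -/
lemma shift_pow_mul_orbitRep_mem (n : ℕ) (f : C₀(X, ℂ)) :
    orbitShift X ^ n * orbitRep σ f ∈ semicrossedProduct σ := by
  induction n generalizing f with
  | zero => simpa using orbitRep_mem f
  | succ n ih =>
    rw [← SetLike.mem_coe, ← isClosed_semicrossedProduct.closure_eq, Metric.mem_closure_iff]
    intro ε hε
    obtain ⟨g, hg⟩ := exists_approx_pull hσ n f (half_pos hε)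
    refine ⟨(orbitShift X * orbitRep σ g) * (orbitShift X ^ n * orbitRep σ f),
      mul_mem (shift_mul_orbitRep_mem g) (ih f), ?_⟩
    have e := shift_pow_mul_orbitRep_mul hσ 1 n g f
    rw [pow_one, add_comm] at e
    rw [e, dist_eq_norm, ← mul_sub, ← repL_apply, ← repL_apply, ← map_sub, repL_apply]
    have h1 : ‖orbitShift X ^ (n + 1)‖ ≤ 1 :=
      (norm_pow_le' _ n.succ_pos).trans (pow_le_one₀ (norm_nonneg _) norm_orbitShift_le)
    calc _ ≤ ‖orbitShift X ^ (n + 1)‖ * ‖orbitRep σ (f - (pull hσ)^[n] g * f)‖ := norm_mul_le _ _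
      _ ≤ 1 * (ε / 2) := by
        gcongr
        exact (norm_orbitRep_le σ _).trans hg
      _ < ε := by linarith

/-- A closed subspace containing all `S ^ n π(f)` contains the semicrossed product. -/
lemma semicrossedProduct_induction (P : Submodule ℂ (Op X))
    (hP : IsClosed (P : Set (Op X)))
    (h : ∀ n f, orbitShift X ^ n * orbitRep σ f ∈ P) {a : Op X}
    (ha : a ∈ semicrossedProduct σ) : a ∈ P := by
  set G : Set (Op X) :=
    {a | ∃ n f, a = orbitShift X ^ n * orbitRep σ f} with hG
  have hGG : Submodule.span ℂ G * Submodule.span ℂ G ≤ Submodule.span ℂ G := by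
    rw [Submodule.span_mul_span]
    refine Submodule.span_mono ?_
    rintro _ ⟨_, ⟨n, f, rfl⟩, _, ⟨m, g, rfl⟩, rfl⟩
    exact ⟨_, _, shift_pow_mul_orbitRep_mul hσ n m f g⟩
  let W : NonUnitalSubalgebra ℂ (Op X) :=
    { Submodule.span ℂ G with
      mul_mem' := fun {a b} ha hb => hGG (Submodule.mul_mem_mul ha hb) }
  have h1 : NonUnitalAlgebra.adjoin ℂ
      (Set.range (fun f : C₀(X, ℂ) => orbitRep σ f) ∪
        Set.range (fun f : C₀(X, ℂ) => orbitShift X * orbitRep σ f)) ≤ W := by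
    refine NonUnitalAlgebra.adjoin_le ?_
    rintro _ (⟨f, rfl⟩ | ⟨f, rfl⟩)
    · exact Submodule.subset_span ⟨0, f, by simp⟩
    · exact Submodule.subset_span ⟨1, f, by simp⟩
  have h2 : Submodule.span ℂ G ≤ P := Submodule.span_le.2 (by rintro _ ⟨n, f, rfl⟩; exact h n f)
  exact closure_minimal (fun b hb => h2 (h1 hb)) hP ha

lemma functional_ext {L M : (Op X) →L[ℂ] ℂ}
    (h : ∀ n f, L (orbitShift X ^ n * orbitRep σ f) = M (orbitShift X ^ n * orbitRep σ f))
    {a : Op X} (ha : a ∈ semicrossedProduct σ) : L a = M a := by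
  have := semicrossedProduct_induction hσ (L - M).ker (L - M).isClosed_ker
    (fun n f => by simp [h n f]) ha
  exact sub_eq_zero.1 this

/-- The sum of two products covers both multiplicativity (`M' = N' = 0`) and the twisted Leibniz
rule. -/
lemma functional_mul {L M N M' N' : (Op X) →L[ℂ] ℂ}
    (h : ∀ n f m g, L (orbitShift X ^ n * orbitRep σ f * (orbitShift X ^ m * orbitRep σ g)) =
      M (orbitShift X ^ n * orbitRep σ f) * N (orbitShift X ^ m * orbitRep σ g) +
      M' (orbitShift X ^ n * orbitRep σ f) * N' (orbitShift X ^ m * orbitRep σ g))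
    {a b : Op X} (ha : a ∈ semicrossedProduct σ)
    (hb : b ∈ semicrossedProduct σ) : L (a * b) = M a * N b + M' a * N' b := by
  have h1 : ∀ n f, L (orbitShift X ^ n * orbitRep σ f * b) =
      M (orbitShift X ^ n * orbitRep σ f) * N b + M' (orbitShift X ^ n * orbitRep σ f) * N' b := by
    intro n f
    set a := orbitShift X ^ n * orbitRep σ f with ha
    exact functional_ext hσ (L := L.comp (ContinuousLinearMap.mul ℂ (Op X) a))
      (M := M a • N + M' a • N') (fun m g => by simpa using h n f m g) hb
  have h2 := functional_ext hσ (L := L.comp ((ContinuousLinearMap.mul ℂ (Op X)).flip b))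
      (M := N b • M + N' b • M')
      (fun n f => (h1 n f).trans (congrArg₂ (· + ·) (mul_comm _ _) (mul_comm _ _))) ha
  rw [mul_comm (M a), mul_comm (M' a)]
  exact h2

lemma shift_mul_mem {a : Op X} (ha : a ∈ semicrossedProduct σ) :
    orbitShift X * a ∈ semicrossedProduct σ := by
  refine semicrossedProduct_induction hσ
    ((semicrossedProduct σ).toSubmodule.comap (LinearMap.mulLeft ℂ (orbitShift X))) ?_ ?_ ha
  · exact isClosed_semicrossedProduct.preimage (continuous_const.mul continuous_id)
  · intro n f
    change orbitShift X * _ ∈ semicrossedProduct σ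
    rw [← mul_assoc, ← pow_succ']
    exact shift_pow_mul_orbitRep_mem hσ _ _

/-- The product of monomials evaluates to `ζ ^ (n + m) f(σ^m x) g(x)`. The iterate `σ^m` is harmless
if `x` is fixed, and for `ζ = 0` only `m = 0` contributes. -/
lemma evalAt_mul {x : X} {ζ : ℂ} (hζ : ‖ζ‖ < 1) (h : ζ = 0 ∨ σ x = x)
    {a b : Op X} (ha : a ∈ semicrossedProduct σ)
    (hb : b ∈ semicrossedProduct σ) : evalAt x ζ (a * b) = evalAt x ζ a * evalAt x ζ b := by
  have := functional_mul hσ (L := evalAt x ζ) (M := evalAt x ζ) (N := evalAt x ζ) (M' := 0)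
    (N' := 0) (fun n f m g => ?_) ha hb
  · simpa using this
  · rw [shift_pow_mul_orbitRep_mul hσ, evalAt_shift_pow_orbitRep σ hζ,
      evalAt_shift_pow_orbitRep σ hζ, evalAt_shift_pow_orbitRep σ hζ]
    simp only [ZeroAtInftyContinuousMap.mul_apply, pull_iterate_apply,
      _root_.zero_apply, mul_zero, add_zero]
    rcases h with rfl | h
    · cases m <;> simp [mul_assoc]
    · rw [Function.iterate_fixed h]
      ring

/-- Degree one arises as `1 + 0` or `0 + 1`; in the latter case `f` is moved past `S`, which puts `σ
x` on the left. Equivalently, these are the entries of an upper triangular `2 × 2` representation.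
-/
lemma coeffOne_mul (x : X) {a b : Op X}
    (ha : a ∈ semicrossedProduct σ) (hb : b ∈ semicrossedProduct σ) :
    coeffOne x (a * b) = coeffOne x a * evalAt x 0 b + evalAt (σ x) 0 a * coeffOne x b := by
  refine functional_mul hσ (fun n f m g => ?_) ha hb
  have h0 : ‖(0 : ℂ)‖ < 1 := by simp
  rw [shift_pow_mul_orbitRep_mul hσ, evalAt_shift_pow_orbitRep σ h0,
      evalAt_shift_pow_orbitRep σ h0, coeffOne_shift_pow_orbitRep, coeffOne_shift_pow_orbitRep,
      coeffOne_shift_pow_orbitRep]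
  rcases n with _ | _ | n <;> rcases m with _ | _ | m <;> (simp; try omega)

/-- Every element of the semicrossed product is `π(h) + (S - ζ) c`. -/
lemma exists_decomposition {ζ : ℂ} (hζ : ‖ζ‖ < 1) {a : Op X}
    (ha : a ∈ semicrossedProduct σ) :
    ∃ h : C₀(X, ℂ), ∃ c ∈ semicrossedProduct σ,
      a = orbitRep σ h + (orbitShift X - ζ • 1) * c := by
  set A := (semicrossedProduct σ).toSubmodule with hA
  have hAc : IsClosed (A : Set (Op X)) := isClosed_semicrossedProduct
  have : CompleteSpace A := hAc.completeSpace_coe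
  -- The range of `T` is closed because `T` is bounded below: `evalAt x ζ` kills `(S - ζ)c` and so
  -- recovers `h`, while `S` being isometric gives `‖(S - ζ)c‖ ≥ (1 - ‖ζ‖)‖c‖`.
  let T : C₀(X, ℂ) × A →L[ℂ] (Op X) :=
    ((repL σ).comp (ContinuousLinearMap.fst ℂ _ _)) +
      (ContinuousLinearMap.mul ℂ (Op X) (orbitShift X - ζ • 1)).comp
        (A.subtypeL.comp (ContinuousLinearMap.snd ℂ _ _))
  have hT : ∀ p, T p = orbitRep σ p.1 + (orbitShift X - ζ • 1) * (p.2 : Op X) :=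
    fun p => rfl
  have hfst : ∀ p, ‖p.1‖ ≤ ‖geom ζ‖ * ‖T p‖ := by
    intro p
    refine norm_le_of_forall_le (by positivity) fun x => ?_
    have : evalAt x ζ (T p) = p.1 x := by
      rw [hT, map_add, evalAt_orbitRep σ hζ, sub_mul, map_sub, evalAt_shift_mul x hζ,
        smul_mul_assoc, one_mul, map_smul, smul_eq_mul, sub_self, add_zero]
    rw [← this]
    exact norm_vecFunctional_le _ _ _
  have hlow : ∀ c : Op X,
      (1 - ‖ζ‖) * ‖c‖ ≤ ‖(orbitShift X - ζ • 1) * c‖ := by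
    intro c
    have h1 : 0 < 1 - ‖ζ‖ := by linarith
    rw [mul_comm, ← le_div_iff₀ h1]
    refine c.opNorm_le_bound (by positivity) fun ξ => ?_
    rw [div_mul_eq_mul_div, le_div_iff₀ h1]
    refine le_trans ?_ (((orbitShift X - ζ • 1) * c).le_opNorm ξ)
    have h2 : ((orbitShift X - ζ • 1) * c) ξ = orbitShift X (c ξ) - ζ • c ξ := by simp
    have h3 := norm_sub_norm_le (orbitShift X (c ξ)) (ζ • c ξ)
    rw [norm_orbitShift_apply, norm_smul] at h3
    rw [h2]
    linarith
  have hsnd : ∀ p, ‖p.2‖ ≤ (1 - ‖ζ‖)⁻¹ * ((1 + ‖geom ζ‖) * ‖T p‖) := by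
    intro p
    have h1 : 0 < 1 - ‖ζ‖ := by linarith
    rw [inv_mul_eq_div, le_div_iff₀ h1, mul_comm]
    refine (hlow p.2).trans ?_
    have : (orbitShift X - ζ • 1) * (p.2 : Op X) = T p - orbitRep σ p.1 := by
      rw [hT]; abel
    rw [this]
    have := norm_sub_le (T p) (orbitRep σ p.1)
    have := norm_orbitRep_le σ p.1
    have := hfst p
    linarith
  have hanti : ∃ K, AntilipschitzWith K T := by
    refine ⟨_, T.antilipschitz_of_bound (K := ‖geom ζ‖₊ +
      (1 - ‖ζ‖).toNNReal⁻¹ * (1 + ‖geom ζ‖₊)) fun p => ?_⟩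
    have h1 : 0 ≤ 1 - ‖ζ‖ := by linarith
    have h2 := hfst p
    have h3 := hsnd p
    have h4 : 0 ≤ ‖geom ζ‖ * ‖T p‖ := by positivity
    push_cast
    rw [Real.coe_toNNReal _ h1, Prod.norm_def]
    have h6 : 0 ≤ (1 - ‖ζ‖)⁻¹ * (1 + ‖geom ζ‖) * ‖T p‖ := by positivity
    rw [add_mul]
    refine max_le (h2.trans (le_add_of_nonneg_right h6)) (h3.trans ?_)
    rw [← mul_assoc]
    exact le_add_of_nonneg_left h4
  obtain ⟨K, hK⟩ := hanti
  have hcl : IsClosed (Set.range T) := hK.isClosed_range T.uniformContinuous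
  have := semicrossedProduct_induction hσ T.range (by rwa [LinearMap.coe_range]) (fun n f => ?_) ha
  · obtain ⟨p, hp⟩ := this
    exact ⟨p.1, p.2, p.2.2, hp.symm⟩
  · induction n with
    | zero => exact ⟨(f, 0), by simp [hT]⟩
    | succ n ih =>
      obtain ⟨p, hp⟩ := ih
      have hp' : T p = _ := hp
      -- `S(π(h) + (S - ζ)c) = ζπ(h) + (S - ζ)(π(h) + Sc)`.
      refine ⟨(ζ • p.1, ⟨orbitRep σ p.1 + orbitShift X * p.2,
        add_mem (orbitRep_mem _) (shift_mul_mem hσ p.2.2)⟩), ?_⟩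
      change T _ = _
      rw [pow_succ', mul_assoc, ← hp', hT, hT]
      simp only [orbitRep_smul, mul_add, sub_mul, mul_sub, smul_mul_assoc, one_mul,
        mul_smul_comm]
      abel

end Structure

/-! ### Automatic continuity, real holomorphic functions, characters of `C₀(X)` -/

section General

/-- Characters of closed subalgebras of Banach algebras are contractive. -/
lemma norm_character_le {B : Type*} [NormedRing B] [NormedAlgebra ℂ B] [CompleteSpace B]
    {A : NonUnitalSubalgebra ℂ B} (hA : IsClosed (A : Set B)) (θ : A →ₙₐ[ℂ] ℂ) (a : A) :
    ‖θ a‖ ≤ ‖(a : B)‖ := by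
  by_contra! h
  have hθ : θ a ≠ 0 := norm_pos_iff.1 ((norm_nonneg _).trans_lt h)
  set c : A := (θ a)⁻¹ • a with hc
  have hθc : θ c = 1 := by rw [hc, map_smul, smul_eq_mul, inv_mul_cancel₀ hθ]
  have hcn : ‖(c : B)‖ < 1 := by
    rw [hc, NonUnitalSubalgebra.coe_smul, norm_smul, norm_inv, inv_mul_eq_div,
      div_lt_one (norm_pos_iff.2 hθ)]
    exact h
  have hpow : ∀ n : ℕ, (c : B) ^ (n + 1) ∈ A := by
    intro n
    induction n with
    | zero => simp
    | succ n ih => rw [pow_succ]; exact mul_mem ih c.2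
  -- The sum `b` of the powers of `c` lies in `A` and satisfies `b = c + cb`; applying `θ` with `θ c
  -- = 1` gives `θ b = 1 + θ b`.
  have hs : Summable fun n : ℕ => (c : B) ^ (n + 1) :=
    (summable_nat_add_iff 1).2 (summable_geometric_of_norm_lt_one hcn)
  obtain ⟨b, hb⟩ := hs
  have hbA : b ∈ A := hA.mem_of_tendsto hb.tendsto_sum_nat
    (Filter.Eventually.of_forall fun n => sum_mem fun i _ => hpow i)
  have h1 : HasSum (fun n : ℕ => (c : B) ^ (n + 1 + 1)) (c * b) := by
    simpa only [← pow_succ'] using hb.mul_left (c : B)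
  have h2 : b = c + c * b := by
    have h3 := (hasSum_nat_add_iff' (f := fun n : ℕ => (c : B) ^ (n + 1)) 1).2 hb
    have h4 := h3.unique h1
    rw [← h4]
    simp
  have h3 : (⟨b, hbA⟩ : A) = c + c * ⟨b, hbA⟩ := Subtype.ext h2
  have h4 := congrArg θ h3
  rw [map_add, map_mul, hθc, one_mul] at h4
  simp at h4

lemma continuous_character {B : Type*} [NormedRing B] [NormedAlgebra ℂ B] [CompleteSpace B]
    {A : NonUnitalSubalgebra ℂ B} (hA : IsClosed (A : Set B)) (θ : A →ₙₐ[ℂ] ℂ) :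
    Continuous θ :=
  AddMonoidHomClass.continuous_of_bound θ 1 fun a =>
    (norm_character_le hA θ a).trans_eq (one_mul ‖(a : B)‖).symm

/-- A holomorphic function on the disc with real values is constant. -/
lemma eq_apply_zero_of_real {g : ℂ → ℂ} (hg : DifferentiableOn ℂ g (Metric.ball 0 1))
    (hr : ∀ z ∈ Metric.ball (0 : ℂ) 1, (g z).im = 0) {z : ℂ} (hz : z ∈ Metric.ball (0 : ℂ) 1) :
    g z = g 0 := by
  have h0 : (0 : ℂ) ∈ Metric.ball (0 : ℂ) 1 := by simp
  rcases (hg.analyticOnNhd Metric.isOpen_ball).is_constant_or_isOpen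
    (convex_ball (0 : ℂ) 1).isPreconnected with ⟨w, hw⟩ | h
  · rw [hw z hz, hw 0 h0]
  · exfalso
    obtain ⟨ε, hε, hball⟩ := Metric.isOpen_iff.1 (h _ subset_rfl Metric.isOpen_ball) (g 0)
      ⟨0, h0, rfl⟩
    have : g 0 + (ε / 2 : ℝ) * Complex.I ∈ Metric.ball (g 0) ε := by
      rw [mem_ball_iff_norm, add_sub_cancel_left, norm_mul, Complex.norm_I, mul_one,
        Complex.norm_real, Real.norm_of_nonneg (by positivity)]
      linarith
    obtain ⟨w, hw, hwe⟩ := hball this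
    have h1 := hr w hw
    rw [hwe] at h1
    simp [hr 0 h0] at h1
    linarith

variable {X : Type*} [TopologicalSpace X] [T2Space X] [LocallyCompactSpace X]

/-- Contractive characters of `C₀(X)` are point evaluations. -/
lemma exists_eval_of_character {χ : C₀(X, ℂ) →ₙₐ[ℂ] ℂ} (hχ : ∀ f, ‖χ f‖ ≤ ‖f‖) (h0 : χ ≠ 0) :
    ∃ x, ∀ f, χ f = f x := by
  obtain ⟨f₀, hf₀⟩ : ∃ f, χ f ≠ 0 := by
    by_contra! h
    exact h0 (NonUnitalAlgHom.ext h)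
  -- Otherwise finitely many `|f|²` with `f ∈ ker χ` sum to some `F ∈ ker χ` bounded below on `K`.
  -- Then `f₀(1 - tF)^n` keeps the value `χ f₀` while its norm drops to `‖χ f₀‖ / 2`, against
  -- contractivity.
  have key : ∃ x, ∀ f, χ f = 0 → f x = 0 := by
    by_contra! hcon
    obtain ⟨K, hK, hKf⟩ := exists_compact_norm_lt f₀ (half_pos (norm_pos_iff.2 hf₀))
    obtain ⟨F, δ, hδ, hF, hFr, hFK⟩ : ∃ F : C₀(X, ℂ), ∃ δ : ℝ, 0 < δ ∧ χ F = 0 ∧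
        (∀ x, ∃ r : ℝ, 0 ≤ r ∧ F x = r) ∧ ∀ x ∈ K, δ ≤ ‖F x‖ := by
      refine hK.induction_on (p := fun s => ∃ F : C₀(X, ℂ), ∃ δ : ℝ, 0 < δ ∧ χ F = 0 ∧
        (∀ x, ∃ r : ℝ, 0 ≤ r ∧ F x = r) ∧ ∀ x ∈ s, δ ≤ ‖F x‖) ?_ ?_ ?_ ?_
      · exact ⟨0, 1, one_pos, map_zero _, fun x => ⟨0, le_rfl, by simp⟩, by simp⟩
      · rintro s t hst ⟨F, δ, h1, h2, h3, h4⟩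
        exact ⟨F, δ, h1, h2, h3, fun x hx => h4 x (hst hx)⟩
      · rintro s t ⟨F, δ, h1, h2, h3, h4⟩ ⟨G, η, k1, k2, k3, k4⟩
        have hFG : ∀ x, ∃ r : ℝ, 0 ≤ r ∧ (F + G) x = r ∧ ‖F x‖ ≤ r ∧ ‖G x‖ ≤ r := by
          intro x
          obtain ⟨r, hr, hFr⟩ := h3 x
          obtain ⟨q, hq, hGq⟩ := k3 x
          refine ⟨r + q, add_nonneg hr hq, ?_, ?_, ?_⟩
          · rw [ZeroAtInftyContinuousMap.add_apply, hFr, hGq]; push_cast; rfl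
          · rw [hFr, Complex.norm_real, Real.norm_of_nonneg hr]; linarith
          · rw [hGq, Complex.norm_real, Real.norm_of_nonneg hq]; linarith
        refine ⟨F + G, min δ η, lt_min h1 k1, by rw [map_add, h2, k2, add_zero],
          fun x => ?_, fun x hx => ?_⟩
        · obtain ⟨r, hr, e, -⟩ := hFG x
          exact ⟨r, hr, e⟩
        · obtain ⟨r, hr, e, i1, i2⟩ := hFG x
          rw [e, Complex.norm_real, Real.norm_of_nonneg hr]
          rcases hx with hx | hx
          · exact (min_le_left _ _).trans ((h4 x hx).trans i1)
          · exact (min_le_right _ _).trans ((k4 x hx).trans i2)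
      · intro x hx
        obtain ⟨f, hf, hfx⟩ := hcon x
        have hn : ∀ y, (star f * f) y = ((‖f y‖ ^ 2 : ℝ) : ℂ) := by
          intro y
          rw [ZeroAtInftyContinuousMap.mul_apply, ZeroAtInftyContinuousMap.star_apply]
          simpa using Complex.conj_mul' (f y)
        have hpos : 0 < ‖f x‖ ^ 2 := by positivity
        have hopen : {y | ‖f x‖ ^ 2 / 2 < ‖f y‖ ^ 2} ∈ nhds x := by
          have hc : Continuous fun y => ‖f y‖ ^ 2 := by fun_prop
          exact (isOpen_lt continuous_const hc).mem_nhds (half_lt_self hpos)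
        refine ⟨_, mem_nhdsWithin_of_mem_nhds hopen, star f * f, ‖f x‖ ^ 2 / 2, half_pos hpos,
          by rw [map_mul, hf, mul_zero], fun y => ⟨_, by positivity, hn y⟩, fun y hy => ?_⟩
        rw [hn, Complex.norm_real, Real.norm_of_nonneg (by positivity)]
        exact (show ‖f x‖ ^ 2 / 2 < ‖f y‖ ^ 2 from hy).le
    -- Small enough that `1 - tF` takes values in `[0, 1]` and `1 - tδ ≥ 0`.
    set t : ℝ := (‖F‖ + δ + 1)⁻¹ with ht
    have hFn := norm_nonneg F
    have ht0 : 0 < t := by positivity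
    have hval : ∀ x, ∃ q : ℝ, 0 ≤ q ∧ q ≤ 1 ∧ 1 - (t : ℂ) * F x = q ∧
        (x ∈ K → q ≤ 1 - t * δ) := by
      intro x
      obtain ⟨r, hr, hFx⟩ := hFr x
      have h1 : ‖F x‖ = r := by rw [hFx, Complex.norm_real, Real.norm_of_nonneg hr]
      have h2 : r ≤ ‖F‖ := h1 ▸ norm_apply_le F x
      refine ⟨1 - t * r, ?_, ?_, by rw [hFx]; push_cast; rfl, fun hx => ?_⟩
      · have : t * r ≤ 1 := by
          rw [ht, inv_mul_le_iff₀ (by positivity)]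
          linarith
        linarith
      · nlinarith
      · have := hFK x hx
        rw [h1] at this
        nlinarith
    have htδ : 0 ≤ 1 - t * δ ∧ 1 - t * δ < 1 := by
      refine ⟨?_, by nlinarith⟩
      have : t * δ ≤ 1 := by
        rw [ht, inv_mul_le_iff₀ (by positivity)]
        linarith
      linarith
    have hseq : ∀ n : ℕ, ∃ h : C₀(X, ℂ), χ h = χ f₀ ∧
        ∀ x, h x = f₀ x * (1 - (t : ℂ) * F x) ^ n := by
      intro n
      induction n with
      | zero => exact ⟨f₀, rfl, by simp⟩
      | succ n ih =>
        obtain ⟨h, h1, h2⟩ := ih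
        refine ⟨h - (t : ℂ) • (F * h), ?_, fun x => ?_⟩
        · rw [map_sub, map_smul, map_mul, hF, zero_mul, smul_zero, sub_zero, h1]
        · simp only [ZeroAtInftyContinuousMap.sub_apply, ZeroAtInftyContinuousMap.smul_apply,
            ZeroAtInftyContinuousMap.mul_apply, smul_eq_mul, h2, pow_succ]
          ring
    have hlim : Filter.Tendsto (fun n : ℕ => ‖f₀‖ * (1 - t * δ) ^ n) Filter.atTop (nhds 0) := by
      simpa using (tendsto_pow_atTop_nhds_zero_of_lt_one htδ.1 htδ.2).const_mul ‖f₀‖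
    obtain ⟨n, hn⟩ := (hlim.eventually (gt_mem_nhds (half_pos (norm_pos_iff.2 hf₀)))).exists
    obtain ⟨h, h1, h2⟩ := hseq n
    have h3 : ‖h‖ ≤ ‖χ f₀‖ / 2 := by
      refine norm_le_of_forall_le (by positivity) fun x => ?_
      obtain ⟨q, hq0, hq1, hq, hqK⟩ := hval x
      rw [h2, hq, norm_mul, norm_pow, Complex.norm_real, Real.norm_of_nonneg hq0]
      by_cases hx : x ∈ K
      · refine le_trans ?_ hn.le
        gcongr
        · exact norm_apply_le f₀ x
        · exact hqK hx
      · refine le_trans ?_ (hKf x hx).le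
        exact mul_le_of_le_one_right (norm_nonneg _) (pow_le_one₀ hq0 hq1)
    have h4 := hχ h
    rw [h1] at h4
    have := norm_pos_iff.2 hf₀
    linarith
  obtain ⟨x, hx⟩ := key
  refine ⟨x, fun f => ?_⟩
  have h1 : ∀ f, χ f₀ * f x = χ f * f₀ x := by
    intro f
    have := hx (χ f₀ • f - χ f • f₀) (by simp [mul_comm])
    simpa [sub_eq_zero] using this
  have h2 : f₀ x ≠ 0 := by
    intro h
    obtain ⟨g, hg, -⟩ := exists_eq_one x
    have := h1 g
    rw [h, hg] at this
    simp [hf₀] at this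
  -- So far `χ` is a multiple of evaluation at `x`; multiplicativity at `f₀²` makes the factor one.
  have h3 := h1 (f₀ * f₀)
  rw [ZeroAtInftyContinuousMap.mul_apply, map_mul] at h3
  have h4 : χ f₀ = f₀ x := by
    have h5 : χ f₀ * f₀ x * (χ f₀ - f₀ x) = 0 := by linear_combination -h3
    rcases mul_eq_zero.1 h5 with h6 | h6
    · exact absurd h6 (mul_ne_zero hf₀ h2)
    · exact sub_eq_zero.1 h6
  have h5 := h1 f
  rw [h4, mul_comm] at h5
  exact (mul_right_cancel₀ h2 h5).symm

end General

/-! ### Classification of the characters of the semicrossed product -/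

section Characters

variable {X : Type*} [TopologicalSpace X] {σ : X → X}

variable (σ) in
/-- The element `π(f)` of the semicrossed product. -/
noncomputable def piElem (f : C₀(X, ℂ)) : semicrossedProduct σ := ⟨orbitRep σ f, orbitRep_mem f⟩

variable (σ) in
/-- The element `S π(f)` of the semicrossed product. -/
noncomputable def shiftElem (f : C₀(X, ℂ)) : semicrossedProduct σ :=
  ⟨orbitShift X * orbitRep σ f, shift_mul_orbitRep_mem f⟩

/-- The homomorphism `f ↦ π(f)` into the semicrossed product. -/
noncomputable def piHom : C₀(X, ℂ) →ₙₐ[ℂ] semicrossedProduct σ where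
  toFun := piElem σ
  map_smul' c f := Subtype.ext (orbitRep_smul σ c f)
  map_zero' := Subtype.ext (map_zero (repL σ))
  map_add' f g := Subtype.ext (orbitRep_add σ f g)
  map_mul' f g := Subtype.ext (orbitRep_mul σ f g)

lemma piElem_mul (f g : C₀(X, ℂ)) : piElem σ (f * g) = piElem σ f * piElem σ g :=
  map_mul piHom f g

lemma shiftElem_mul (f g : C₀(X, ℂ)) : shiftElem σ (f * g) = shiftElem σ f * piElem σ g := by
  refine Subtype.ext ?_
  change orbitShift X * orbitRep σ (f * g) = orbitShift X * orbitRep σ f * orbitRep σ g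
  rw [orbitRep_mul, mul_assoc]

lemma shiftElem_zero : shiftElem σ (0 : C₀(X, ℂ)) = 0 := by
  refine Subtype.ext ?_
  change orbitShift X * repL σ 0 = 0
  rw [map_zero, mul_zero]

lemma norm_character_le' (θ : semicrossedProduct σ →ₙₐ[ℂ] ℂ) (a : semicrossedProduct σ) :
    ‖θ a‖ ≤ ‖(a : Op X)‖ := norm_character_le isClosed_semicrossedProduct θ a

/-- Characters are continuous, so their equalizer is closed and agreement on generators suffices. -/
lemma character_ext {θ θ' : semicrossedProduct σ →ₙₐ[ℂ] ℂ}
    (h1 : ∀ f, θ (piElem σ f) = θ' (piElem σ f))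
    (h2 : ∀ f, θ (shiftElem σ f) = θ' (shiftElem σ f)) : θ = θ' := by
  let P : NonUnitalSubalgebra ℂ (Op X) :=
    (NonUnitalAlgHom.equalizer θ θ').map (NonUnitalSubalgebraClass.subtype (semicrossedProduct σ))
  have hP : IsClosed (P : Set (Op X)) := by
    have hc : IsClosed {a | θ a = θ' a} :=
      isClosed_eq (continuous_character isClosed_semicrossedProduct θ)
        (continuous_character isClosed_semicrossedProduct θ')
    exact isClosed_semicrossedProduct.isClosedEmbedding_subtypeVal.isClosedMap _ hc
  have hle : semicrossedProduct σ ≤ P := by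
    refine NonUnitalSubalgebra.topologicalClosure_minimal (NonUnitalAlgebra.adjoin_le ?_) hP
    rintro _ (⟨f, rfl⟩ | ⟨f, rfl⟩)
    · exact ⟨piElem σ f, h1 f, rfl⟩
    · exact ⟨shiftElem σ f, h2 f, rfl⟩
  refine NonUnitalAlgHom.ext fun a => ?_
  obtain ⟨b, hb, hba⟩ := hle a.2
  have : b = a := Subtype.ext hba
  exact this ▸ hb

/-- The character `θ` is given by `π(f) ↦ f(x)` and `S π(f) ↦ ζ f(x)`. -/
def IsOver (θ : semicrossedProduct σ →ₙₐ[ℂ] ℂ) (x : X) (ζ : ℂ) : Prop :=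
  (∀ f, θ (piElem σ f) = f x) ∧ ∀ f, θ (shiftElem σ f) = ζ * f x

lemma IsOver.unique {θ θ' : semicrossedProduct σ →ₙₐ[ℂ] ℂ} {x : X} {ζ : ℂ}
    (h : IsOver θ x ζ) (h' : IsOver θ' x ζ) : θ = θ' :=
  character_ext (fun f => (h.1 f).trans (h'.1 f).symm) (fun f => (h.2 f).trans (h'.2 f).symm)

variable [T2Space X] [LocallyCompactSpace X]

lemma IsOver.ne_zero {θ : semicrossedProduct σ →ₙₐ[ℂ] ℂ} {x : X} {ζ : ℂ}
    (h : IsOver θ x ζ) : θ ≠ 0 := by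
  rintro rfl
  obtain ⟨f, hf, -⟩ := exists_eq_one x
  have := h.1 f
  rw [hf] at this
  simp at this

lemma IsOver.point_unique {θ : semicrossedProduct σ →ₙₐ[ℂ] ℂ} {x y : X} {ζ ζ' : ℂ}
    (h : IsOver θ x ζ) (h' : IsOver θ y ζ') : x = y := by
  by_contra hne
  obtain ⟨f, h1, h2⟩ := exists_separating hne
  have := (h.1 f).symm.trans (h'.1 f)
  rw [h1, h2] at this
  simp at this

variable (hσ : IsProperMap σ)
include hσ

lemma piElem_mul_shiftElem (f g : C₀(X, ℂ)) :
    piElem σ f * shiftElem σ g = shiftElem σ (pull hσ f) * piElem σ g := by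
  refine Subtype.ext ?_
  change orbitRep σ f * (orbitShift X * orbitRep σ g) =
    orbitShift X * orbitRep σ (pull hσ f) * orbitRep σ g
  rw [← mul_assoc, orbitRep_mul_orbitShift hσ]

/-- Classification of the characters of the semicrossed product. -/
lemma exists_isOver {θ : semicrossedProduct σ →ₙₐ[ℂ] ℂ} (hθ : θ ≠ 0) :
    ∃ x ζ, IsOver θ x ζ ∧ ‖ζ‖ ≤ 1 ∧ (ζ = 0 ∨ σ x = x) := by
  -- If `θ` kills every `π(f)`, it also kills `Sπ(gf) = Sπ(g)π(f)`, and these approximate `Sπ(f)`.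
  have hne : θ.comp piHom ≠ 0 := by
    intro h
    have h1 : ∀ f, θ (piElem σ f) = 0 := fun f => DFunLike.congr_fun h f
    refine hθ (character_ext h1 fun f => ?_)
    refine norm_le_zero_iff.1 (le_of_forall_pos_le_add fun ε hε => ?_)
    obtain ⟨g, hg⟩ := exists_approx_pull hσ 0 f hε
    have h2 : shiftElem σ f = shiftElem σ (f - g * f) + shiftElem σ g * piElem σ f := by
      rw [← shiftElem_mul]
      refine Subtype.ext ?_
      change orbitShift X * repL σ f =
        orbitShift X * repL σ (f - g * f) + orbitShift X * repL σ (g * f)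
      rw [← mul_add, ← map_add, sub_add_cancel]
    rw [h2, map_add, map_mul, h1, mul_zero, add_zero, zero_add]
    refine (norm_character_le' θ _).trans ?_
    refine (norm_mul_le _ _).trans ?_
    calc _ ≤ 1 * ε := by
          gcongr
          · exact norm_orbitShift_le
          · exact (norm_orbitRep_le _ _).trans hg
      _ = ε := one_mul ε
  obtain ⟨x, hx⟩ := exists_eval_of_character
    (fun f => (norm_character_le' θ (piElem σ f)).trans (norm_orbitRep_le σ f)) hne
  have hx : ∀ f, θ (piElem σ f) = f x := hx
  obtain ⟨f₀, hf₀, hf₀n⟩ := exists_eq_one x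
  have hover : IsOver θ x (θ (shiftElem σ f₀)) := by
    refine ⟨hx, fun f => ?_⟩
    have h1 : θ (shiftElem σ (f * f₀)) = θ (shiftElem σ f) := by
      rw [shiftElem_mul, map_mul, hx, hf₀, mul_one]
    rw [← h1, mul_comm f, shiftElem_mul, map_mul, hx]
  refine ⟨x, θ (shiftElem σ f₀), hover, ?_, ?_⟩
  · refine (norm_character_le' θ _).trans ((norm_mul_le _ _).trans ?_)
    exact mul_le_one₀ norm_orbitShift_le (norm_nonneg _) ((norm_orbitRep_le _ _).trans hf₀n)
  -- Covariance gives `g(x) ζ = ζ g(σ x)`; a `g` separating `x` from `σ x` contradicts `ζ ≠ 0`.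
  · by_contra! h
    obtain ⟨g, h1, h2⟩ := exists_separating h.2
    have h3 := congrArg θ (piElem_mul_shiftElem hσ g f₀)
    rw [map_mul, map_mul, hx, hx, hover.2 (pull hσ g), pull_apply, h1, h2, hf₀] at h3
    simp [h.1] at h3

/-- The character `S ^ n π(f) ↦ ζ ^ n f(x)`, where `‖ζ‖ < 1`, and `ζ = 0` or `σ(x) = x`. -/
noncomputable def evalChar {x : X} {ζ : ℂ} (hζ : ‖ζ‖ < 1) (h : ζ = 0 ∨ σ x = x) :
    semicrossedProduct σ →ₙₐ[ℂ] ℂ where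
  toFun a := evalAt x ζ a
  map_smul' c a := map_smul (evalAt x ζ) c (a : Op X)
  map_zero' := map_zero (evalAt x ζ)
  map_add' a b := map_add (evalAt x ζ) (a : Op X) b
  map_mul' a b := evalAt_mul hσ hζ h a.2 b.2

lemma evalChar_apply {x : X} {ζ : ℂ} (hζ : ‖ζ‖ < 1) (h : ζ = 0 ∨ σ x = x)
    (a : semicrossedProduct σ) : evalChar hσ hζ h a = evalAt x ζ a := rfl

lemma isOver_evalChar {x : X} {ζ : ℂ} (hζ : ‖ζ‖ < 1) (h : ζ = 0 ∨ σ x = x) :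
    IsOver (evalChar hσ hζ h) x ζ := by
  refine ⟨fun f => evalAt_orbitRep σ hζ f x, fun f => ?_⟩
  have h1 := evalAt_shift_pow_orbitRep σ hζ 1 f x
  rw [pow_one, pow_one] at h1
  exact h1

/-- As `S` need not be in the algebra, `Sa` is multiplied by `π(g)` with `g(x) = 1`, and `π(g)Sa =
Sπ(g ∘ σ)a` is a product inside it. -/
lemma IsOver.apply_shift_mul {θ : semicrossedProduct σ →ₙₐ[ℂ] ℂ} {x : X} {ζ : ℂ}
    (hθ : IsOver θ x ζ) (h : ζ = 0 ∨ σ x = x) (a : semicrossedProduct σ) :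
    θ ⟨orbitShift X * a, shift_mul_mem hσ a.2⟩ = ζ * θ a := by
  obtain ⟨g, hg, -⟩ := exists_eq_one x
  have h1 : piElem σ g * ⟨orbitShift X * a, shift_mul_mem hσ a.2⟩ =
      shiftElem σ (pull hσ g) * a := by
    refine Subtype.ext ?_
    change orbitRep σ g * (orbitShift X * a) = orbitShift X * orbitRep σ (pull hσ g) * a
    rw [← mul_assoc, orbitRep_mul_orbitShift hσ]
  have h2 := congrArg θ h1
  rw [map_mul, map_mul, hθ.1, hθ.2, pull_apply, hg, one_mul] at h2
  rw [h2]
  rcases h with rfl | h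
  · simp
  · rw [h, hg, mul_one]

lemma IsOver.apply_shift_pow_mul {θ : semicrossedProduct σ →ₙₐ[ℂ] ℂ} {x : X} {ζ : ℂ}
    (hθ : IsOver θ x ζ) (h : ζ = 0 ∨ σ x = x) (n : ℕ) (f : C₀(X, ℂ)) :
    θ ⟨orbitShift X ^ n * orbitRep σ f, shift_pow_mul_orbitRep_mem hσ n f⟩ = ζ ^ n * f x := by
  induction n with
  | zero =>
    simp only [pow_zero, one_mul]
    exact hθ.1 f
  | succ n ih =>
    rw [pow_succ' ζ, mul_assoc, ← ih, ← hθ.apply_shift_mul hσ h]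
    exact congrArg θ (Subtype.ext (by simp only [pow_succ', mul_assoc]))

/-- Radial limits of the characters over a fixed point. -/
lemma IsOver.tendsto_evalAt {θ : semicrossedProduct σ →ₙₐ[ℂ] ℂ} {x : X} {ζ : ℂ}
    (hθ : IsOver θ x ζ) (hζ : ‖ζ‖ ≤ 1) (h : σ x = x) (a : semicrossedProduct σ) :
    Filter.Tendsto (fun r : ℝ => evalAt x (r * ζ) (a : Op X)) (nhdsWithin 1 (Set.Ioo 0 1))
      (nhds (θ a)) := by
  have hlt : ∀ᶠ r : ℝ in nhdsWithin 1 (Set.Ioo 0 1), ‖(r : ℂ) * ζ‖ < 1 := by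
    filter_upwards [self_mem_nhdsWithin] with r hr
    rw [norm_mul, Complex.norm_real, Real.norm_of_nonneg hr.1.le]
    nlinarith [hr.1, hr.2, norm_nonneg ζ]
  let P : Submodule ℂ (Op X) :=
    { carrier := {a | ∃ ha : a ∈ semicrossedProduct σ,
        Filter.Tendsto (fun r : ℝ => evalAt x (r * ζ) a) (nhdsWithin 1 (Set.Ioo 0 1))
          (nhds (θ ⟨a, ha⟩))}
      add_mem' := by
        rintro a b ⟨ha, h1⟩ ⟨hb, h2⟩
        refine ⟨add_mem ha hb, ?_⟩
        simp only [map_add]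
        have : θ ⟨a + b, add_mem ha hb⟩ = θ ⟨a, ha⟩ + θ ⟨b, hb⟩ := map_add θ ⟨a, ha⟩ ⟨b, hb⟩
        rw [this]
        exact h1.add h2
      zero_mem' := by
        refine ⟨zero_mem _, ?_⟩
        have : θ ⟨0, zero_mem _⟩ = 0 := map_zero θ
        simp only [map_zero, this]
        exact tendsto_const_nhds
      smul_mem' := by
        rintro c a ⟨ha, h1⟩
        refine ⟨SMulMemClass.smul_mem c ha, ?_⟩
        simp only [map_smul]
        have : θ ⟨c • a, SMulMemClass.smul_mem c ha⟩ = c • θ ⟨a, ha⟩ := map_smul θ c ⟨a, ha⟩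
        rw [this]
        exact h1.const_smul c }
  suffices hP : (a : Op X) ∈ P from hP.2
  refine semicrossedProduct_induction hσ P ?_ ?_ a.2
  -- An `ε/3` argument: `θ` and all evaluations at `rζ` are contractive on the algebra.
  · refine isClosed_of_closure_subset fun b hb => ?_
    have hPA : (P : Set (Op X)) ⊆ semicrossedProduct σ := fun _ h => h.1
    have hbA : b ∈ semicrossedProduct σ := closure_minimal hPA isClosed_semicrossedProduct hb
    refine ⟨hbA, Metric.tendsto_nhds.2 fun ε hε => ?_⟩
    obtain ⟨c, hc, hbc⟩ := Metric.mem_closure_iff.1 hb (ε / 3) (by positivity)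
    obtain ⟨hcA, hlim⟩ := hc
    rw [dist_eq_norm] at hbc
    filter_upwards [hlt, Metric.tendsto_nhds.1 hlim (ε / 3) (by positivity)] with r hr hrc
    rw [dist_eq_norm] at hrc ⊢
    have h1 : ‖evalAt x (r * ζ) (b - c)‖ ≤ ‖b - c‖ :=
      norm_character_le' (evalChar hσ hr (Or.inr h)) ⟨b - c, sub_mem hbA hcA⟩
    have h2 : ‖θ ⟨b, hbA⟩ - θ ⟨c, hcA⟩‖ ≤ ‖b - c‖ := by
      rw [← map_sub]
      exact norm_character_le' θ _
    rw [map_sub] at h1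
    have h3 : evalAt x (r * ζ) b - θ ⟨b, hbA⟩ = (evalAt x (r * ζ) b - evalAt x (r * ζ) c) +
      (evalAt x (r * ζ) c - θ ⟨c, hcA⟩) - (θ ⟨b, hbA⟩ - θ ⟨c, hcA⟩) := by ring
    rw [h3]
    refine (norm_sub_le _ _).trans_lt ?_
    have := norm_add_le (evalAt x (r * ζ) b - evalAt x (r * ζ) c)
      (evalAt x (r * ζ) c - θ ⟨c, hcA⟩)
    linarith
  · intro n f
    refine ⟨shift_pow_mul_orbitRep_mem hσ n f, ?_⟩
    rw [hθ.apply_shift_pow_mul hσ (Or.inr h)]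
    have hcont : Continuous fun r : ℝ => ((r : ℂ) * ζ) ^ n * f x := by fun_prop
    have h1 := (hcont.tendsto 1).mono_left (nhdsWithin_le_nhds (s := Set.Ioo 0 1))
    simp only [Complex.ofReal_one, one_mul] at h1
    refine h1.congr' ?_
    filter_upwards [hlt] with r hr
    rw [evalAt_shift_pow_orbitRep σ hr]

/-- If all characters are real at `a`, then their values at `a` are given by a function
on `X`. -/
lemma exists_function_of_real {a : semicrossedProduct σ}
    (ha : ∀ θ : semicrossedProduct σ →ₙₐ[ℂ] ℂ, (θ a).im = 0) :
    ∃ F : C₀(X, ℂ), ∀ θ : semicrossedProduct σ →ₙₐ[ℂ] ℂ, ∀ x ζ, IsOver θ x ζ → θ a = F x := by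
  have h0 : ‖(0 : ℂ)‖ < 1 := by simp
  -- At `ζ = 0` the decomposition exhibits the zeroth Fourier coefficient as an element of `C₀(X)`.
  obtain ⟨F, c, hc, hac⟩ := exists_decomposition hσ h0 a.2
  have hF : ∀ x, evalAt x 0 (a : Op X) = F x := by
    intro x
    rw [hac, map_add, evalAt_orbitRep σ h0, zero_smul, sub_zero, evalAt_shift_mul x h0, zero_mul,
      add_zero]
  refine ⟨F, fun θ x ζ hθ => ?_⟩
  obtain ⟨x', ζ', hθ', hζ', hfix⟩ := exists_isOver hσ hθ.ne_zero
  obtain rfl := hθ.point_unique hθ'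
  rw [← hF]
  rcases hfix with rfl | hfix
  · rw [hθ'.unique (isOver_evalChar hσ h0 (Or.inl rfl)), evalChar_apply]
  · have hconst : ∀ z ∈ Metric.ball (0 : ℂ) 1,
        evalAt x z (a : Op X) = evalAt x 0 (a : Op X) := fun z hz =>
      eq_apply_zero_of_real (differentiableOn_evalAt x (a : Op X))
        (fun w hw => ha (evalChar hσ (mem_ball_zero_iff.1 hw) (Or.inr hfix))) hz
    -- Since `‖ζ'‖ = 1` is possible, constancy on the open disc is carried to `θ` by the radial
    -- limit.
    have hlim := hθ'.tendsto_evalAt hσ hζ' hfix a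
    have hne : (nhdsWithin (1 : ℝ) (Set.Ioo 0 1)).NeBot := by
      rw [← mem_closure_iff_nhdsWithin_neBot, closure_Ioo zero_ne_one]
      simp
    refine tendsto_nhds_unique hlim (tendsto_const_nhds.congr' ?_)
    filter_upwards [self_mem_nhdsWithin] with r hr
    refine (hconst _ ?_).symm
    rw [mem_ball_zero_iff, norm_mul, Complex.norm_real, Real.norm_of_nonneg hr.1.le]
    nlinarith [hr.1, hr.2, norm_nonneg ζ']

/-- The values of the characters at `π(f)` are real when `f` is real. -/
lemma apply_piElem_real {f : C₀(X, ℂ)} (hf : ∀ x, (f x).im = 0)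
    (θ : semicrossedProduct σ →ₙₐ[ℂ] ℂ) : (θ (piElem σ f)).im = 0 := by
  by_cases hθ : θ = 0
  · simp [hθ]
  · obtain ⟨x, ζ, h, -⟩ := exists_isOver hσ hθ
    rw [h.1, hf]

end Characters

/-! ### Twisted derivations between characters -/

section Derivations

variable {X : Type*} [TopologicalSpace X] [T2Space X] [LocallyCompactSpace X] {σ : X → X}

lemma cutoff_shift_mul_eq_zero (hσ : IsProperMap σ) (ζ : ℂ) {k g : C₀(X, ℂ)} (h1 : k * g = 0)
    (h2 : pull hσ k * g = 0) :
    (shiftElem σ (pull hσ k) - ζ • piElem σ k) * piElem σ g = 0 := by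
  have h3 : piElem σ (0 : C₀(X, ℂ)) = 0 := map_zero piHom
  rw [sub_mul, smul_mul_assoc, ← shiftElem_mul, ← piElem_mul, h1, h2, h3, shiftElem_zero,
    smul_zero, sub_zero]

/-- In `a = π(h) + (S - ζ)c` the diagonal part dies between `π(k)` and `π(g)`, and `π(k)(S - ζ)` is
an element of the algebra although `S - ζ` need not be. -/
lemma exists_cutoff_mul_eq (hσ : IsProperMap σ) {ζ : ℂ} (hζ : ‖ζ‖ < 1) {k g : C₀(X, ℂ)}
    (hkg : k * g = 0) (a : semicrossedProduct σ) :
    ∃ c : semicrossedProduct σ, piElem σ k * (a * piElem σ g) =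
      (shiftElem σ (pull hσ k) - ζ • piElem σ k) * (c * piElem σ g) := by
  obtain ⟨h, c, hc, hac⟩ := exists_decomposition hσ hζ a.2
  refine ⟨⟨c, hc⟩, Subtype.ext ?_⟩
  change orbitRep σ k * ((a : Op X) * orbitRep σ g) =
    (orbitShift X * orbitRep σ (pull hσ k) - ζ • orbitRep σ k) * (c * orbitRep σ g)
  have e : orbitRep σ k * (orbitRep σ h * orbitRep σ g) = 0 := by
    have h1 : k * (h * g) = 0 := by rw [mul_left_comm, hkg, mul_zero]
    rw [← orbitRep_mul, ← orbitRep_mul, h1, ← repL_apply, map_zero]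
  have e2 : orbitShift X * orbitRep σ (pull hσ k) - ζ • orbitRep σ k =
      orbitRep σ k * (orbitShift X - ζ • 1) := by
    rw [mul_sub, orbitRep_mul_orbitShift hσ, mul_smul_comm, mul_one]
  rw [hac, e2, add_mul, mul_add, e, zero_add, mul_assoc, mul_assoc]

/-- There is no outer derivation relative to a pair of characters over `(x, y)` if `y` is neither
`x` nor `σ(x)` and the second character is in the open disc. -/
lemma derivation_eq_zero (hσ : IsProperMap σ) {θ θ' : semicrossedProduct σ →ₙₐ[ℂ] ℂ} {x y : X}
    {ζ ζ' : ℂ} (hθ : IsOver θ x ζ) (hθ' : IsOver θ' y ζ') (hζ' : ‖ζ'‖ < 1)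
    (hy : ζ' = 0 ∨ σ y = y) (hyx : y ≠ x) (hyσ : y ≠ σ x) (d : semicrossedProduct σ →ₗ[ℂ] ℂ)
    (hd : ∀ a b, d (a * b) = d a * θ b + θ' a * d b) {a : semicrossedProduct σ}
    (ha : θ a = 0) (ha' : θ' a = 0) : d a = 0 := by
  obtain ⟨V₁, U₁, hV₁, hU₁, hyV₁, hxU₁, hd₁⟩ := t2_separation hyx
  obtain ⟨V₂, U₂, hV₂, hU₂, hyV₂, hxU₂, hd₂⟩ := t2_separation hyσ
  obtain ⟨g, hg1, hg0, -⟩ := exists_eq_one_at (hU₁.inter (hU₂.preimage hσ.continuous))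
    (show x ∈ U₁ ∩ σ ⁻¹' U₂ from ⟨hxU₁, hxU₂⟩)
  obtain ⟨k, hk1, hk0, -⟩ := exists_eq_one_at (hV₁.inter hV₂)
    (show y ∈ V₁ ∩ V₂ from ⟨hyV₁, hyV₂⟩)
  have hkg : ∀ z, k z * g z = 0 := by
    intro z
    by_cases hz : z ∈ U₁
    · rw [hk0 z fun h => Set.disjoint_left.1 hd₁ h.1 hz, zero_mul]
    · rw [hg0 z fun h => hz h.1, mul_zero]
  have hkσg : ∀ z, k (σ z) * g z = 0 := by
    intro z
    by_cases hz : σ z ∈ U₂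
    · rw [hk0 _ fun h => Set.disjoint_left.1 hd₂ h.2 hz, zero_mul]
    · rw [hg0 z fun h => hz h.2, mul_zero]
  have hkg' : k * g = 0 := ZeroAtInftyContinuousMap.ext hkg
  obtain ⟨c, hprod⟩ := exists_cutoff_mul_eq hσ hζ' hkg' a
  have hug := cutoff_shift_mul_eq_zero hσ ζ' hkg' (ZeroAtInftyContinuousMap.ext hkσg)
  set u : semicrossedProduct σ := shiftElem σ (pull hσ k) - ζ' • piElem σ k with hu
  have hθ'u : θ' u = 0 := by
    rw [hu, map_sub, map_smul, hθ'.1, hθ'.2, pull_apply, hk1, smul_eq_mul]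
    rcases hy with rfl | hy
    · simp
    · rw [hy, hk1, sub_self]
  have hdu : d u = 0 := by
    have := hd u (piElem σ g)
    rwa [hug, map_zero, hθ.1, hg1, hθ'u, mul_one, zero_mul, add_zero, eq_comm] at this
  -- The cutoffs equal one at `y` and `x`, so they do not change `d` on `ker θ ∩ ker θ'`. The
  -- cut-off element factors through `u`, where both `d` and `θ'` vanish.
  have hcut : d (piElem σ k * (a * piElem σ g)) = d a := by
    rw [hd, hd, map_mul, ha, hθ.1, hθ'.1, hg1, hk1, ha']
    ring
  rw [← hcut, hprod, hd, hdu, hθ'u, zero_mul, zero_mul, add_zero]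

end Derivations

/-! ### From an algebra isomorphism to a conjugacy -/

section Isomorphisms

variable {X₁ X₂ : Type*} [TopologicalSpace X₁] [TopologicalSpace X₂]
    {σ₁ : X₁ → X₁} {σ₂ : X₂ → X₂}

lemma comp_right_injective {φ : semicrossedProduct σ₁ →ₙₐ[ℂ] semicrossedProduct σ₂}
    {ψ : semicrossedProduct σ₂ →ₙₐ[ℂ] semicrossedProduct σ₁}
    (hψφ : ∀ a, ψ (φ a) = a) {θ θ' : semicrossedProduct σ₁ →ₙₐ[ℂ] ℂ}
    (h : θ.comp ψ = θ'.comp ψ) : θ = θ' := by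
  refine NonUnitalAlgHom.ext fun a => ?_
  have := DFunLike.congr_fun h (φ a)
  rwa [NonUnitalAlgHom.comp_apply, NonUnitalAlgHom.comp_apply, hψφ] at this

/-- The characters over `x` correspond to characters over `γ(x)`. -/
def Intertwines (ψ : semicrossedProduct σ₂ →ₙₐ[ℂ] semicrossedProduct σ₁) (γ : X₁ → X₂) : Prop :=
  ∀ θ x ζ, IsOver θ x ζ → ∃ ζ', IsOver (θ.comp ψ) (γ x) ζ' ∧ ‖ζ'‖ ≤ 1 ∧
    (ζ' = 0 ∨ σ₂ (γ x) = γ x)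

variable [LocallyCompactSpace X₁] [T2Space X₁]

lemma Intertwines.leftInverse (hσ₁ : IsProperMap σ₁)
    {φ : semicrossedProduct σ₁ →ₙₐ[ℂ] semicrossedProduct σ₂}
    {ψ : semicrossedProduct σ₂ →ₙₐ[ℂ] semicrossedProduct σ₁}
    (hψφ : ∀ a, ψ (φ a) = a) {γ : X₁ → X₂} {δ : X₂ → X₁} (hγ : Intertwines ψ γ)
    (hδ : Intertwines φ δ) (x : X₁) : δ (γ x) = x := by
  have h0 : ‖(0 : ℂ)‖ < 1 := by simp
  have h := isOver_evalChar hσ₁ (x := x) h0 (Or.inl rfl)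
  obtain ⟨ζ₁, h1, -⟩ := hγ _ _ _ h
  obtain ⟨ζ₂, h2, -⟩ := hδ _ _ _ h1
  have e : ((evalChar hσ₁ (x := x) h0 (Or.inl rfl)).comp ψ).comp φ =
      evalChar hσ₁ (x := x) h0 (Or.inl rfl) :=
    NonUnitalAlgHom.ext fun a => by rw [NonUnitalAlgHom.comp_apply, NonUnitalAlgHom.comp_apply, hψφ]
  rw [e] at h2
  exact h2.point_unique h

lemma evalChar_ne_evalChar_zero (hσ₁ : IsProperMap σ₁) {x : X₁} (hx : σ₁ x = x) {z : ℂ} (hz : ‖z‖ < 1)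
    (hz0 : z ≠ 0) : evalChar hσ₁ hz (Or.inr hx) ≠
      evalChar hσ₁ (x := x) (ζ := 0) (by simp) (Or.inr hx) := by
  intro h
  obtain ⟨f, hf, -⟩ := exists_eq_one x
  have h1 := (isOver_evalChar hσ₁ hz (Or.inr hx)).2 f
  rw [h, (isOver_evalChar hσ₁ _ _).2, hf, zero_mul, mul_one] at h1
  exact hz0 h1.symm

/-- The characters at `ζ = 0` and `ζ = 1/2` over `x` stay distinct, whereas a non-fixed point
carries only one character. -/
lemma Intertwines.fixed (hσ₁ : IsProperMap σ₁)
    {φ : semicrossedProduct σ₁ →ₙₐ[ℂ] semicrossedProduct σ₂}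
    {ψ : semicrossedProduct σ₂ →ₙₐ[ℂ] semicrossedProduct σ₁}
    (hψφ : ∀ a, ψ (φ a) = a) {γ : X₁ → X₂} (hγ : Intertwines ψ γ)
    {x : X₁} (hx : σ₁ x = x) : σ₂ (γ x) = γ x := by
  have h0 : ‖(0 : ℂ)‖ < 1 := by simp
  have h12 : ‖(1 / 2 : ℂ)‖ < 1 := by norm_num
  obtain ⟨ζ₀, k0, -, i0⟩ := hγ _ _ _ (isOver_evalChar hσ₁ h0 (Or.inr hx))
  obtain ⟨ζ₁, k1, -, i1⟩ := hγ _ _ _ (isOver_evalChar hσ₁ h12 (Or.inr hx))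
  rcases i0 with rfl | i0
  · rcases i1 with rfl | i1
    · exact absurd (comp_right_injective hψφ (k1.unique k0))
        (evalChar_ne_evalChar_zero hσ₁ hx h12 (by norm_num))
    · exact i1
  · exact i0

variable [LocallyCompactSpace X₂] [T2Space X₂]

lemma exists_intertwining (hσ₁ : IsProperMap σ₁) (hσ₂ : IsProperMap σ₂)
    {φ : semicrossedProduct σ₁ →ₙₐ[ℂ] semicrossedProduct σ₂}
    {ψ : semicrossedProduct σ₂ →ₙₐ[ℂ] semicrossedProduct σ₁}
    (hψφ : ∀ a, ψ (φ a) = a) : ∃ γ : X₁ → X₂, Continuous γ ∧ Intertwines ψ γ := by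
  have hne : ∀ θ : semicrossedProduct σ₁ →ₙₐ[ℂ] ℂ, θ ≠ 0 → θ.comp ψ ≠ 0 := by
    intro θ hθ h
    refine hθ (NonUnitalAlgHom.ext fun a => ?_)
    have := DFunLike.congr_fun h (φ a)
    rwa [NonUnitalAlgHom.comp_apply, hψφ] at this
  have h0 : ‖(0 : ℂ)‖ < 1 := by simp
  have hpt : ∀ x : X₁, ∃ y ζ', IsOver ((evalChar hσ₁ (x := x) h0 (Or.inl rfl)).comp ψ) y ζ' := by
    intro x
    obtain ⟨y, ζ', h, -⟩ := exists_isOver hσ₂ (hne _ (isOver_evalChar hσ₁ h0 (Or.inl rfl)).ne_zero)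
    exact ⟨y, ζ', h⟩
  choose γ ζγ hγ using hpt
  -- For real `f`, all characters are real at `ψ(π(f))`, so their values depend only on the base
  -- point. This gives continuity of `γ` and its independence of `ζ`.
  have hreal : ∀ f : C₀(X₂, ℂ), (∀ y, (f y).im = 0) → ∃ F : C₀(X₁, ℂ),
      (∀ θ x ζ, IsOver θ x ζ → θ (ψ (piElem σ₂ f)) = F x) ∧ ∀ x, f (γ x) = F x := by
    intro f hf
    obtain ⟨F, hF⟩ := exists_function_of_real hσ₁ (a := ψ (piElem σ₂ f)) fun θ =>
      apply_piElem_real hσ₂ hf (θ.comp ψ)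
    refine ⟨F, hF, fun x => ?_⟩
    rw [← (hγ x).1 f]
    exact hF _ x 0 (isOver_evalChar hσ₁ h0 (Or.inl rfl))
  refine ⟨γ, continuous_iff_continuousAt.2 fun x => ?_, ?_⟩
  · intro U hU
    obtain ⟨V, hVU, hV, hxV⟩ := mem_nhds_iff.1 hU
    obtain ⟨g, hg1, hg0, hgr⟩ := exists_eq_one_at hV hxV
    obtain ⟨F, -, hF⟩ := hreal g fun y => by
      obtain ⟨r, hr, -⟩ := hgr y
      rw [hr, Complex.ofReal_im]
    have hopen : {x' | F x' ≠ 0} ∈ nhds x := by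
      have hc : Continuous fun x' => F x' := map_continuous F
      refine (isOpen_ne_fun hc continuous_const).mem_nhds ?_
      rw [Set.mem_ofPred_eq, ← hF, hg1]
      exact one_ne_zero
    refine Filter.mem_map.2 (Filter.mem_of_superset hopen fun x' hx' => hVU ?_)
    by_contra h
    exact hx' (by rw [← hF, hg0 _ h])
  · intro θ x ζ hθ
    obtain ⟨y, ζ', hy, h1, h2⟩ := exists_isOver hσ₂ (hne θ hθ.ne_zero)
    have hyx : y = γ x := by
      by_contra hne
      obtain ⟨g, hg1, hg0, hgr⟩ := exists_eq_one_at (isOpen_compl_singleton (x := γ x))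
        (show y ∈ ({γ x}ᶜ : Set X₂) from hne)
      obtain ⟨F, hF, hFγ⟩ := hreal g fun y => by
        obtain ⟨r, hr, -⟩ := hgr y
        rw [hr, Complex.ofReal_im]
      have e1 := hF θ x ζ hθ
      have e2 : θ (ψ (piElem σ₂ g)) = g y := hy.1 g
      rw [e2, hg1, ← hFγ, hg0 _ (by simp)] at e1
      exact one_ne_zero e1
    subst hyx
    exact ⟨ζ', hy, h1, h2⟩

/-- The center of the disc over a fixed point goes to the open disc over its image. -/
lemma Intertwines.norm_lt_one (hσ₁ : IsProperMap σ₁)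
    {φ : semicrossedProduct σ₁ →ₙₐ[ℂ] semicrossedProduct σ₂}
    {ψ : semicrossedProduct σ₂ →ₙₐ[ℂ] semicrossedProduct σ₁}
    (hψφ : ∀ a, ψ (φ a) = a) {γ : X₁ → X₂} (hγ : Intertwines ψ γ)
    {x : X₁} (hx : σ₁ x = x) {h0 : ‖(0 : ℂ)‖ < 1} {ζ' : ℂ}
    (hζ' : IsOver ((evalChar hσ₁ h0 (Or.inr hx)).comp ψ) (γ x) ζ') : ‖ζ'‖ < 1 := by
  obtain ⟨f, hf, -⟩ := exists_eq_one (γ x)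
  -- `k z` is the disc coordinate of the image of the character at `z`. If `‖k 0‖ = 1`, the maximum
  -- principle makes `k` constant, against injectivity on characters.
  set k : ℂ → ℂ := fun z => evalAt x z (ψ (shiftElem σ₂ f) : Op X₁) with hk
  have hkz : ∀ z (hz : ‖z‖ < 1),
      IsOver ((evalChar hσ₁ hz (Or.inr hx)).comp ψ) (γ x) (k z) ∧ ‖k z‖ ≤ 1 := by
    intro z hz
    obtain ⟨ζ, h1, h2, -⟩ := hγ _ _ _ (isOver_evalChar hσ₁ hz (Or.inr hx))
    have : k z = ζ := by
      have := h1.2 f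
      rw [hf, mul_one] at this
      exact this
    rw [this]
    exact ⟨h1, h2⟩
  have hk0 : ζ' = k 0 := by
    have h1 := hζ'.2 f
    have h2 := (hkz 0 h0).1.2 f
    rw [hf, mul_one] at h1 h2
    exact h1.symm.trans h2
  rw [hk0]
  by_contra hcon
  have h1 : ‖k 0‖ = 1 := le_antisymm (hkz 0 h0).2 (not_lt.1 hcon)
  have hmax : IsMaxOn (norm ∘ k) (Metric.ball (0 : ℂ) 1) 0 := fun z hz => by
    simp only [Set.mem_ofPred_eq, Function.comp_apply, h1]
    exact (hkz z (mem_ball_zero_iff.1 hz)).2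
  have hconst := Complex.eqOn_of_isPreconnected_of_isMaxOn_norm
    (convex_ball (0 : ℂ) 1).isPreconnected Metric.isOpen_ball
    (differentiableOn_evalAt x (ψ (shiftElem σ₂ f) : Op X₁)) (by simp) hmax
  have h12 : ‖(1 / 2 : ℂ)‖ < 1 := by norm_num
  have h2 : k (1 / 2) = k 0 := hconst (mem_ball_zero_iff.2 h12)
  have h3 := (hkz _ h12).1
  rw [h2] at h3
  exact evalChar_ne_evalChar_zero hσ₁ hx h12 (by norm_num)
    (comp_right_injective hψφ (h3.unique (hkz 0 h0).1))

lemma conjugate_of_inverse (hσ₁ : IsProperMap σ₁) (hσ₂ : IsProperMap σ₂)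
    {φ : semicrossedProduct σ₁ →ₙₐ[ℂ] semicrossedProduct σ₂}
    {ψ : semicrossedProduct σ₂ →ₙₐ[ℂ] semicrossedProduct σ₁}
    (hψφ : ∀ a, ψ (φ a) = a) (hφψ : ∀ b, φ (ψ b) = b) : Conjugate σ₁ σ₂ := by
  obtain ⟨γ, hγc, hγ⟩ := exists_intertwining hσ₁ hσ₂ hψφ
  obtain ⟨δ, hδc, hδ⟩ := exists_intertwining hσ₂ hσ₁ hφψ
  have hδγ := hγ.leftInverse hσ₁ hψφ hδ
  have hγδ := hδ.leftInverse hσ₂ hφψ hγ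
  refine ⟨⟨⟨γ, δ, hδγ, hγδ⟩, hγc, hδc⟩, funext fun x => ?_⟩
  change γ (σ₁ x) = σ₂ (γ x)
  by_cases hx : σ₁ x = x
  · rw [hγ.fixed hσ₁ hψφ hx, hx]
  by_contra hcon
  have h0 : ‖(0 : ℂ)‖ < 1 := by simp
  obtain ⟨ζ, h1, -⟩ := hγ _ _ _ (isOver_evalChar hσ₁ (x := x) h0 (Or.inl rfl))
  obtain ⟨ζ', h2, -, h3⟩ := hγ _ _ _ (isOver_evalChar hσ₁ (x := σ₁ x) h0 (Or.inl rfl))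
  -- If `γ (σ₁ x)` is fixed then so is `σ₁ x`, by `Intertwines.fixed` for the inverse, and
  -- `norm_lt_one` applies there.
  have hζ' : ‖ζ'‖ < 1 := by
    rcases h3 with rfl | h3
    · exact h0
    · have h4 := hδ.fixed hσ₂ hφψ h3
      rw [hδγ] at h4
      exact hγ.norm_lt_one hσ₁ hψφ (h0 := h0) h4 h2
  have hne : γ (σ₁ x) ≠ γ x := fun h => hx (by rw [← hδγ (σ₁ x), h, hδγ])
  let d : semicrossedProduct σ₂ →ₗ[ℂ] ℂ :=
    { toFun := fun b => coeffOne x (ψ b : Op X₁)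
      map_add' := fun a b => by rw [map_add]; exact map_add (coeffOne x) _ _
      map_smul' := fun c a => by rw [map_smul]; exact map_smul (coeffOne x) c _ }
  obtain ⟨f, hf, -⟩ := exists_eq_one x
  have hover : ∀ y, evalAt y 0 (shiftElem σ₁ f : Op X₁) = 0 := fun y => by
    have := (isOver_evalChar hσ₁ (x := y) h0 (Or.inl rfl)).2 f
    rwa [zero_mul] at this
  have hzero := derivation_eq_zero hσ₂ h1 h2 hζ' h3 hne hcon d (fun a b => by
    change coeffOne x (ψ (a * b) : Op X₁) = _
    rw [map_mul]
    exact coeffOne_mul hσ₁ x (ψ a).2 (ψ b).2) (a := φ (shiftElem σ₁ f))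
    (by
      rw [NonUnitalAlgHom.comp_apply, hψφ]
      exact hover x)
    (by
      rw [NonUnitalAlgHom.comp_apply, hψφ]
      exact hover (σ₁ x))
  -- Both central characters vanish at `Sπ(f)`, but its first coefficient at `x` is `f(x) = 1`.
  have hone : d (φ (shiftElem σ₁ f)) = 1 := by
    change coeffOne x (ψ (φ (shiftElem σ₁ f)) : Op X₁) = 1
    rw [hψφ, ← hf]
    have := coeffOne_shift_pow_orbitRep σ₁ 1 f x
    rwa [pow_one, if_pos rfl] at this
  rw [hone] at hzero
  exact one_ne_zero hzero

end Isomorphisms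

/-! ### From a conjugacy to an algebra isomorphism -/

section Relabeling

/-- Relabeling of the summands of the orbit space along a bijection. -/
noncomputable def relabel {X₁ X₂ : Type*} (γ : X₁ ≃ X₂) : OrbitSpace X₁ →ₗᵢ[ℂ] OrbitSpace X₂ where
  toFun ξ := ⟨fun y => ξ (γ.symm y), memℓp_gen
    ((γ.symm.summable_iff (f := fun x => ‖ξ x‖ ^ (2 : ℝ≥0∞).toReal)).2
      (lp.hasSum_norm (p := 2) (by norm_num) ξ).summable)⟩
  map_add' _ _ := rfl
  map_smul' _ _ := rfl
  norm_map' ξ := by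
    refine (Real.rpow_left_inj (norm_nonneg _) (norm_nonneg _)
      (z := (2 : ℝ≥0∞).toReal) (by norm_num)).1 ?_
    have h1 := lp.hasSum_norm (p := 2) (by norm_num) ξ
    rw [← γ.symm.hasSum_iff] at h1
    exact (lp.hasSum_norm (p := 2) (by norm_num) _).unique h1

@[simp] lemma relabel_apply {X₁ X₂ : Type*} (γ : X₁ ≃ X₂) (ξ : OrbitSpace X₁) (y : X₂) :
    relabel γ ξ y = ξ (γ.symm y) := rfl

/-- Conjugation of operators by `relabel γ`. -/
noncomputable def relabelOp {X₁ X₂ : Type*} (γ : X₁ ≃ X₂) (a : Op X₁) : Op X₂ :=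
  (relabel γ).toContinuousLinearMap.comp (a.comp (relabel γ.symm).toContinuousLinearMap)

lemma relabelOp_apply {X₁ X₂ : Type*} (γ : X₁ ≃ X₂) (a : Op X₁) (ξ : OrbitSpace X₂) :
    relabelOp γ a ξ = relabel γ (a (relabel γ.symm ξ)) := rfl

lemma relabelOp_symm {X₁ X₂ : Type*} (γ : X₁ ≃ X₂) (a : Op X₁) :
    relabelOp γ.symm (relabelOp γ a) = a := by
  have h : ∀ ξ : OrbitSpace X₁, relabel γ.symm (relabel γ ξ) = ξ := fun ξ =>
    orbitSpace_ext fun x n => by simp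
  ext1 ξ
  simp only [relabelOp_apply, Equiv.symm_symm, h]

lemma relabelOp_mul {X₁ X₂ : Type*} (γ : X₁ ≃ X₂) (a b : Op X₁) :
    relabelOp γ (a * b) = relabelOp γ a * relabelOp γ b := by
  have h : ∀ ξ : OrbitSpace X₁, relabel γ.symm (relabel γ ξ) = ξ := fun ξ =>
    orbitSpace_ext fun x n => by simp
  ext1 ξ
  simp only [relabelOp_apply, mul_apply_eq_comp, h]

/-- Conjugation by `relabel γ` as a bounded linear map. -/
noncomputable def relabelL {X₁ X₂ : Type*} (γ : X₁ ≃ X₂) : Op X₁ →L[ℂ] Op X₂ :=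
  (ContinuousLinearMap.compL ℂ _ _ _ (relabel γ).toContinuousLinearMap).comp
    ((ContinuousLinearMap.compL ℂ _ _ _).flip (relabel γ.symm).toContinuousLinearMap)

variable {X₁ X₂ : Type*}
    [TopologicalSpace X₁] [LocallyCompactSpace X₁] [T2Space X₁]
    [TopologicalSpace X₂] [LocallyCompactSpace X₂] [T2Space X₂]
    {σ₁ : X₁ → X₁} {σ₂ : X₂ → X₂}

/-- Conjugation sends `S` to `S` and `π(f)` to `π(f ∘ γ⁻¹)`, since `γ⁻¹` carries `σ₂`-orbits to
`σ₁`-orbits. -/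
lemma relabelOp_mem (hσ₁ : IsProperMap σ₁) (hσ₂ : IsProperMap σ₂) (γ : X₁ ≃ₜ X₂)
    (h : γ ∘ σ₁ = σ₂ ∘ γ) {a : Op X₁} (ha : a ∈ semicrossedProduct σ₁) :
    relabelOp γ.toEquiv a ∈ semicrossedProduct σ₂ := by
  refine semicrossedProduct_induction hσ₁
    ((semicrossedProduct σ₂).toSubmodule.comap (relabelL γ.toEquiv).toLinearMap) ?_ ?_ ha
  · exact isClosed_semicrossedProduct.preimage (relabelL γ.toEquiv).continuous
  intro n f
  change relabelOp γ.toEquiv _ ∈ semicrossedProduct σ₂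
  have hS : relabelOp γ.toEquiv (orbitShift X₁) = orbitShift X₂ := by
    ext1 ξ
    refine orbitSpace_ext fun y n => ?_
    cases n <;> simp [relabelOp_apply]
  have hf : relabelOp γ.toEquiv (orbitRep σ₁ f) =
      orbitRep σ₂ (f.comp ⟨⟨γ.symm, γ.symm.continuous⟩,
        γ.symm.isClosedEmbedding.tendsto_cocompact⟩) := by
    have hs : Function.Semiconj γ σ₁ σ₂ := fun x => congrFun h x
    ext1 ξ
    refine orbitSpace_ext fun y n => ?_
    have e : σ₁^[n] (γ.symm y) = γ.symm (σ₂^[n] y) := by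
      rw [Homeomorph.eq_symm_apply, (hs.iterate_right n).eq, Homeomorph.apply_symm_apply]
    simp [relabelOp_apply, e]
  induction n with
  | zero =>
    rw [pow_zero, one_mul, hf]
    exact orbitRep_mem _
  | succ n ih =>
    rw [pow_succ', mul_assoc, relabelOp_mul, hS]
    exact shift_mul_mem hσ₂ ih

lemma algebraIsomorphic_of_conjugate (hσ₁ : IsProperMap σ₁) (hσ₂ : IsProperMap σ₂)
    (h : Conjugate σ₁ σ₂) :
    AlgebraIsomorphic (semicrossedProduct σ₁) (semicrossedProduct σ₂) := by
  obtain ⟨γ, hγ⟩ := h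
  have hγ' : γ.symm ∘ σ₂ = σ₁ ∘ γ.symm := by
    funext y
    have := congrFun hγ (γ.symm y)
    simp only [Function.comp_apply, Homeomorph.apply_symm_apply] at this
    simp only [Function.comp_apply, ← this, Homeomorph.symm_apply_apply]
  refine ⟨{ toFun := fun a => ⟨relabelOp γ.toEquiv a, relabelOp_mem hσ₁ hσ₂ γ hγ a.2⟩
            map_smul' := fun c a => Subtype.ext (map_smul (relabelL γ.toEquiv) c (a : Op X₁))
            map_zero' := Subtype.ext (map_zero (relabelL γ.toEquiv))
            map_add' := fun a b => Subtype.ext (map_add (relabelL γ.toEquiv) (a : Op X₁) b)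
            map_mul' := fun a b => Subtype.ext (relabelOp_mul γ.toEquiv a b) }, ?_⟩
  refine Function.bijective_iff_has_inverse.2
    ⟨fun b => ⟨relabelOp γ.symm.toEquiv b, relabelOp_mem hσ₂ hσ₁ γ.symm hγ' b.2⟩,
      fun a => Subtype.ext (relabelOp_symm γ.toEquiv (a : Op X₁)),
      fun b => Subtype.ext (relabelOp_symm γ.symm.toEquiv (b : Op X₂))⟩

end Relabeling

end Semicrossed

theorem mainTheorem2 {X₁ X₂ : Type*}
    [TopologicalSpace X₁] [LocallyCompactSpace X₁] [T2Space X₁]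
    [TopologicalSpace X₂] [LocallyCompactSpace X₂] [T2Space X₂]
    (σ₁ : X₁ → X₁) (hσ₁ : IsProperMap σ₁) (σ₂ : X₂ → X₂) (hσ₂ : IsProperMap σ₂) :
    Semicrossed.Conjugate σ₁ σ₂ ↔
      Semicrossed.AlgebraIsomorphic
        (Semicrossed.semicrossedProduct σ₁) (Semicrossed.semicrossedProduct σ₂) := by
  refine ⟨Semicrossed.algebraIsomorphic_of_conjugate hσ₁ hσ₂, ?_⟩
  rintro ⟨φ, hφ⟩
  obtain ⟨g, hl, hr⟩ := Function.bijective_iff_has_inverse.1 hφ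
  exact Semicrossed.conjugate_of_inverse hσ₁ hσ₂ (φ := φ)
    (ψ := NonUnitalAlgHom.inverse φ g hl hr) hl hr
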